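/- **Theorem (Success probability of dual-branch MRC).** Let $\lambda>0$, $d>0$, $\alpha>2$, $\mathtt{SNR}\in(0,\infty)$, $T>0$, $m_{\mathrm I}>0$ be real numbers and let $m_{\mathrm D}\ge 1$ be an integer. Let $\Phi=\{\mathsf x_i\}_{i\ge 0}$ be a stationary Poisson point process of density $\lambda$ in $\mathbb R^2$ (the interferer locations; the receiver is at the origin). Let $\mathsf g_1,\mathsf g_2$ be the power fading gains of the desired link to the two antennas, Gamma distributed with shape $m_{\mathrm D}$ and scale $1/m_{\mathrm D}$, and let $\mathsf h_{n,i}$ ($n=1,2$, $i\ge 0$) be the power fading gains of the link from interferer $i$ to antenna $n$, Gamma distributed with shape $m_{\mathrm I}$ and scale $1/m_{\mathrm I}$. All fading gains are mutually independent and independent of $(\mathsf x_i)_{i\ge 0}$. Put $$\mathsf I_n=d^{\alpha}\sum_{i}\mathsf h_{n,i}\|\mathsf x_i\|^{-\alpha},\qquad \mathtt{SINR}_{\mathrm{MRC}}=\frac{\mathsf g_1}{\mathsf I_1+\mathtt{SNR}^{-1}}+\frac{\mathsf g_2}{\mathsf I_2+\mathtt{SNR}^{-1}} .$$ For $z>0$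 and $s,t>0$ let $$\mathcal A(z,s,t)=\begin{cases} s^{2/\alpha}(T-z)^{2/\alpha}d^2\,\Gamma(1-\tfrac2\alpha)\left(\tfrac{m_{\mathrm D}}{m_{\mathrm I}}\right)^{2/\alpha}\Gamma(\tfrac2\alpha+2m_{\mathrm I})\;{}_2\mathbf F_1\!\left(-\tfrac2\alpha,m_{\mathrm I},2m_{\mathrm I};1-\tfrac{zt}{(T-z)s}\right), & z<T,\\[1ex] (zt)^{2/\alpha}d^2\,\Gamma(1-\tfrac2\alpha)\left(\tfrac{m_{\mathrm D}}{m_{\mathrm I}}\right)^{2/\alpha}\dfrac{\Gamma(\tfrac2\alpha+m_{\mathrm I})}{\Gamma(m_{\mathrm I})}, & z\ge T,\end{cases}$$ where ${}_2\mathbf F_1(a,b,c;\cdot)={}_2F_1(a,b,c;\cdot)/\Gamma(c)$ is the regularized Gauss hypergeometric function (principal branch, i.e. the analytic continuation of the hypergeometric series to $\mathbb C\setminus[1,\infty)$), and let $$E_z(s,t)=\exp\!\left(-\frac{(T-z)^{+}s\,m_{\mathrm D}}{\mathtt{SNR}}-\frac{z\,t\,m_{\mathrm D}}{\mathtt{SNR}}-\pi\lambda\,\mathcal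 A(z,s,t)\right),\qquad (y)^+=\max\{0,y\}.$$ Then for every $z>0$ the function $E_z$ is infinitely differentiable near $(s,t)=(1,1)$, the integrals below converge absolutely, and $$\mathbb P\left(\mathtt{SINR}_{\mathrm{MRC}}\ge T\right)=\sum_{k=0}^{m_{\mathrm D}-1}\frac{(-1)^{k+m_{\mathrm D}}}{k!\,\Gamma(m_{\mathrm D})}\int_0^\infty\frac1z\left.\frac{\partial^{k}}{\partial s^{k}}\frac{\partial^{m_{\mathrm D}}}{\partial t^{m_{\mathrm D}}}E_z(s,t)\right|_{s=1,\,t=1}\mathrm dz .$$ -/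

import Mathlib

open MeasureTheory ProbabilityTheory Set Filter Topology
open scoped ENNReal

namespace DualBranchMRC

/-! ### The regularized Gauss hypergeometric function -/

/-- The weight `u ^ (b - 1) * (1 - u) ^ (c - b - 1)` of Euler's integral; it serves only to prove
that the continuation below exists. -/
noncomputable def gaussWeight (b c : ℂ) (u : ℝ) : ℂ :=
  (u : ℂ) ^ (b - 1) * (1 - (u : ℂ)) ^ (c - b - 1)

theorem kernel_mem_slitPlane {w : ℂ} (hw : 1 - w ∈ Complex.slitPlane) {u : ℝ}
    (hu : u ∈ Icc (0 : ℝ) 1) : 1 - (u : ℂ) * w ∈ Complex.slitPlane := by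
  have h := Complex.isOpen_slitPlane
  have hs := Complex.starConvex_one_slitPlane
  have := hs hw (a := 1 - u) (b := u) (by linarith [hu.2]) hu.1 (by ring)
  convert this using 1
  simp
  ring

/-- For `0 < Re b < Re c` the regularized Gauss series extends analytically from the unit disc to
`ℂ ∖ [1, ∞)`. -/
theorem exists_gauss_continuation (a b c : ℂ) (hb : 0 < b.re) (hbc : b.re < c.re) :
    ∃ F : ℂ → ℂ, AnalyticOnNhd ℂ F {w | 1 - w ∈ Complex.slitPlane} ∧
      ∀ w : ℂ, ‖w‖ < 1 → F w = Complex.regularizedGaussHGFun a b c w := by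
  have hcb : 0 < (c - b).re := by simpa using hbc
  have hφ : IntegrableOn (gaussWeight b c) (Ioc 0 1) := by
    have := Complex.betaIntegral_convergent hb hcb
    rwa [intervalIntegrable_iff_integrableOn_Ioc_of_le zero_le_one] at this
  have hU : IsOpen {w : ℂ | 1 - w ∈ Complex.slitPlane} :=
    Complex.isOpen_slitPlane.preimage (by fun_prop)
  have hK : ∀ a : ℂ, ∀ w, 1 - w ∈ Complex.slitPlane →
      ContinuousOn (fun u : ℝ => (1 - (u : ℂ) * w) ^ (-a)) (Icc 0 1) := fun a w hw u hu =>
    ContinuousAt.continuousWithinAt (ContinuousAt.cpow (by fun_prop) (by fun_prop)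
      (kernel_mem_slitPlane hw hu))
  have hKm : ∀ a : ℂ, ∀ w, 1 - w ∈ Complex.slitPlane → AEStronglyMeasurable
      (fun u : ℝ => (1 - (u : ℂ) * w) ^ (-a)) (volume.restrict (Ioc 0 1)) := fun a w hw =>
    ((hK a w hw).mono Ioc_subset_Icc_self).aestronglyMeasurable measurableSet_Ioc
  have hKi : ∀ a : ℂ, ∀ w, 1 - w ∈ Complex.slitPlane → IntegrableOn
      (fun u : ℝ => gaussWeight b c u * (1 - (u : ℂ) * w) ^ (-a)) (Ioc 0 1) := by
    intro a w hw
    obtain ⟨C, hC⟩ := isCompact_Icc.exists_bound_of_continuousOn (hK a w hw)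
    refine hφ.mul_bdd (c := C) (hKm a w hw) ?_
    filter_upwards [ae_restrict_mem measurableSet_Ioc] with u hu
    exact hC u (Ioc_subset_Icc_self hu)
  refine ⟨fun w => (Complex.Gamma b * Complex.Gamma (c - b))⁻¹ *
    ∫ u in Ioc (0 : ℝ) 1, gaussWeight b c u * (1 - (u : ℂ) * w) ^ (-a), ?_, ?_⟩
  · refine DifferentiableOn.analyticOnNhd (fun w₀ hw₀ => ?_) hU
    refine DifferentiableAt.differentiableWithinAt (DifferentiableAt.const_mul ?_ _)
    obtain ⟨r, hr, hrU⟩ := Metric.nhds_basis_closedBall.mem_iff.1 (hU.mem_nhds hw₀)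
    have hcont : ContinuousOn
        (fun p : ℂ × ℝ => -a * (1 - (p.2 : ℂ) * p.1) ^ (-a - 1) * -(p.2 : ℂ))
        (Metric.closedBall w₀ r ×ˢ Icc (0 : ℝ) 1) := by
      have h0 : ContinuousOn (fun p : ℂ × ℝ => (1 - (p.2 : ℂ) * p.1) ^ (-a - 1))
          (Metric.closedBall w₀ r ×ˢ Icc (0 : ℝ) 1) := by
        refine ContinuousOn.cpow ?_ continuousOn_const fun p hp =>
          kernel_mem_slitPlane (hrU hp.1) hp.2
        fun_prop
      have h1 : ContinuousOn (fun p : ℂ × ℝ => -(p.2 : ℂ))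
          (Metric.closedBall w₀ r ×ˢ Icc (0 : ℝ) 1) := by fun_prop
      exact (continuousOn_const.mul h0).mul h1
    obtain ⟨C, hC⟩ := ((isCompact_closedBall w₀ r).prod isCompact_Icc).exists_bound_of_continuousOn
      hcont
    have := hasDerivAt_integral_of_dominated_loc_of_deriv_le
      (μ := volume.restrict (Ioc (0 : ℝ) 1)) (s := Metric.closedBall w₀ r) (x₀ := w₀)
      (F := fun w u => gaussWeight b c u * (1 - (u : ℂ) * w) ^ (-a))
      (F' := fun w u => gaussWeight b c u * (-a * (1 - (u : ℂ) * w) ^ (-a - 1) * -(u : ℂ)))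
      (bound := fun u => ‖gaussWeight b c u‖ * C)
      (Metric.closedBall_mem_nhds _ hr)
      (by
        filter_upwards [hU.mem_nhds hw₀] with w hw
        exact (hKi a w hw).aestronglyMeasurable)
      (hKi a w₀ hw₀)
      (by
        refine hφ.aestronglyMeasurable.mul (AEStronglyMeasurable.mul ?_ (by fun_prop))
        have := (hKm (a + 1) w₀ hw₀).const_mul (-a)
        simpa [neg_add', sub_eq_add_neg, add_comm] using this)
      (by
        filter_upwards [ae_restrict_mem measurableSet_Ioc] with u hu w hw
        rw [norm_mul]
        exact mul_le_mul_of_nonneg_left (hC (w, u) ⟨hw, Ioc_subset_Icc_self hu⟩) (norm_nonneg _))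
      (hφ.norm.mul_const C)
      (by
        filter_upwards [ae_restrict_mem measurableSet_Ioc] with u hu w hw
        have h1 : HasDerivAt (fun w : ℂ => 1 - (u : ℂ) * w) (-(u : ℂ)) w := by
          simpa using ((hasDerivAt_id w).const_mul (u : ℂ)).const_sub 1
        exact (h1.cpow_const (kernel_mem_slitPlane (hrU hw) (Ioc_subset_Icc_self hu))).const_mul _)
    exact this.2.differentiableAt
  · intro w hw
    have hc0 : 0 < c.re := hb.trans hbc
    set p : FormalMultilinearSeries ℂ ℂ ℂ := .ofScalars ℂ fun n : ℕ => Ring.choose (a + n - 1) n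
    have hp := Complex.one_div_one_sub_cpow_hasFPowerSeriesOnBall_zero a
    have happ : ∀ (n : ℕ) (v : ℂ), p n (fun _ => v) = Ring.choose (a + n - 1) n * v ^ n := by
      intro n v
      simp [p, mul_comm]
    have hmem : ∀ v : ℂ, ‖v‖ < 1 → v ∈ Metric.eball (0 : ℂ) 1 := by
      intro v hv
      rw [← ENNReal.ofReal_one, Metric.eball_ofReal]
      simpa using hv
    have hsum : Summable fun n : ℕ => ‖Ring.choose (a + n - 1) n‖ * ‖w‖ ^ n := by
      have := p.summable_norm_apply (x := w)
        (Metric.eball_subset_eball hp.r_le (hmem w hw))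
      simpa [happ] using this
    have hF : ∀ n : ℕ, IntegrableOn (fun u : ℝ => gaussWeight b c u *
        (Ring.choose (a + n - 1) n * ((u : ℂ) * w) ^ n)) (Ioc 0 1) := by
      intro n
      have hcn : ContinuousOn (fun u : ℝ => Ring.choose (a + n - 1) n * ((u : ℂ) * w) ^ n)
        (Icc 0 1) := by fun_prop
      obtain ⟨C, hC⟩ := isCompact_Icc.exists_bound_of_continuousOn hcn
      refine hφ.mul_bdd (c := C)
        ((hcn.mono Ioc_subset_Icc_self).aestronglyMeasurable measurableSet_Ioc) ?_
      filter_upwards [ae_restrict_mem measurableSet_Ioc] with u hu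
      exact hC u (Ioc_subset_Icc_self hu)
    have hS : Summable fun n : ℕ => ∫ u in Ioc (0 : ℝ) 1, ‖gaussWeight b c u *
        (Ring.choose (a + n - 1) n * ((u : ℂ) * w) ^ n)‖ := by
      refine Summable.of_nonneg_of_le (fun n => integral_nonneg fun _ => norm_nonneg _) (fun n => ?_)
        (hsum.mul_left (∫ u in Ioc (0 : ℝ) 1, ‖gaussWeight b c u‖))
      rw [← integral_mul_const]
      refine setIntegral_mono_on (hF n).norm (hφ.norm.mul_const _) measurableSet_Ioc fun u hu => ?_
      simp only [norm_mul, norm_pow, mul_pow, Complex.norm_real, Real.norm_eq_abs,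
        abs_of_pos hu.1]
      have h1 : u ^ n ≤ 1 := pow_le_one₀ hu.1.le hu.2
      gcongr
      exact mul_le_of_le_one_left (by positivity) h1
    have key := hasSum_integral_of_summable_integral_norm hF hS
    have hval : ∀ n : ℕ, ∫ u in Ioc (0 : ℝ) 1, gaussWeight b c u *
        (Ring.choose (a + n - 1) n * ((u : ℂ) * w) ^ n) =
        (Complex.Gamma b * Complex.Gamma (c - b)) *
          (Complex.regularizedGaussHGFunSeries a b c n fun _ => w) := by
      intro n
      have hb' : ∀ k : ℕ, b ≠ -k := fun k h => by
        have := congrArg Complex.re h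
        simp at this
        have : (0 : ℝ) ≤ k := k.cast_nonneg
        linarith
      have hbn : 0 < (b + n).re := by
        have : (0 : ℝ) ≤ n := n.cast_nonneg
        simp
        linarith
      have hint : ∫ u in Ioc (0 : ℝ) 1, gaussWeight b c u * (u : ℂ) ^ n =
          Complex.betaIntegral (b + n) (c - b) := by
        rw [Complex.betaIntegral, intervalIntegral.integral_of_le zero_le_one]
        refine setIntegral_congr_fun measurableSet_Ioc fun u hu => ?_
        have hu0 : (u : ℂ) ≠ 0 := by exact_mod_cast hu.1.ne'
        simp only [gaussWeight]
        rw [show b + n - 1 = (b - 1) + n by ring, Complex.cpow_add _ _ hu0, Complex.cpow_natCast]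
        ring
      have hfac : Ring.choose (a + n - 1) n = (ascPochhammer ℂ n).eval a / n.factorial := by
        rw [← Ring.multichoose_eq, eq_div_iff (by exact_mod_cast n.factorial_ne_zero),
          ← Polynomial.ascPochhammer_smeval_eq_eval,
          ← Ring.factorial_nsmul_multichoose_eq_ascPochhammer, nsmul_eq_mul, mul_comm]
      calc _ = ∫ u in Ioc (0 : ℝ) 1, (gaussWeight b c u * (u : ℂ) ^ n) *
            (Ring.choose (a + n - 1) n * w ^ n) := by
            congr 1; ext u; rw [mul_pow]; ring
        _ = _ := by
            rw [integral_mul_const, hint, Complex.betaIntegral_eq_Gamma_mul_div _ _ hbn hcb, hfac,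
              FormalMultilinearSeries.apply_eq_prod_smul_coeff,
              Complex.coeff_regularizedGaussHGFunSeries, ← Complex.Gamma_add_nat_div_Gamma_eq b hb',
              show b + n + (c - b) = c + n by ring]
            have := Complex.Gamma_ne_zero_of_re_pos hb
            simp
            field_simp
    have hsumK : ∀ u ∈ Ioc (0 : ℝ) 1, ∑' n : ℕ, gaussWeight b c u *
        (Ring.choose (a + n - 1) n * ((u : ℂ) * w) ^ n) =
        gaussWeight b c u * (1 - (u : ℂ) * w) ^ (-a) := by
      intro u hu
      have huw : ‖(u : ℂ) * w‖ < 1 := by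
        rw [norm_mul, Complex.norm_real, Real.norm_eq_abs, abs_of_pos hu.1]
        nlinarith [norm_nonneg w, hu.2, hu.1]
      have := (hp.hasSum (hmem _ huw)).mul_left (gaussWeight b c u)
      simp only [zero_add] at this
      rw [Complex.cpow_neg, ← one_div, ← this.tsum_eq]
      exact tsum_congr fun n => by rw [happ]
    have hne : Complex.Gamma b * Complex.Gamma (c - b) ≠ 0 :=
      mul_ne_zero (Complex.Gamma_ne_zero_of_re_pos hb) (Complex.Gamma_ne_zero_of_re_pos hcb)
    beta_reduce
    rw [setIntegral_congr_fun measurableSet_Ioc fun u hu => (hsumK u hu).symm, ← key.tsum_eq,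
      tsum_congr hval, tsum_mul_left, inv_mul_cancel_left₀ hne]
    rfl

/-- `F` is the principal branch of the regularized Gauss hypergeometric function
`₂F₁(a, b; c; ·) / Γ(c)`: it is analytic on `ℂ ∖ [1, ∞)` and is given by the power series on the
unit disc. -/
def IsGaussContinuation (a b c : ℂ) (F : ℂ → ℂ) : Prop :=
  AnalyticOnNhd ℂ F {w | 1 - w ∈ Complex.slitPlane} ∧
    ∀ w : ℂ, ‖w‖ < 1 → F w = Complex.regularizedGaussHGFun a b c w

/-- The principal branch of the regularized Gauss hypergeometric function on `ℂ ∖ [1, ∞)`, i.e. the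
analytic continuation of the regularized power series. -/
noncomputable def regularizedGauss (a b c : ℂ) : ℂ → ℂ :=
  Classical.epsilon (IsGaussContinuation a b c)

theorem regularizedGauss_spec (a b c : ℂ) (hb : 0 < b.re) (hbc : b.re < c.re) :
    IsGaussContinuation a b c (regularizedGauss a b c) :=
  Classical.epsilon_spec (exists_gauss_continuation a b c hb hbc)

/-- The continuation is unique on `ℂ ∖ [1, ∞)`. -/
theorem IsGaussContinuation.eqOn {a b c : ℂ} {F G : ℂ → ℂ} (hF : IsGaussContinuation a b c F)
    (hG : IsGaussContinuation a b c G) : EqOn F G {w | 1 - w ∈ Complex.slitPlane} := by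
  have hpre : IsPreconnected {w : ℂ | 1 - w ∈ Complex.slitPlane} := by
    have h : {w : ℂ | 1 - w ∈ Complex.slitPlane} = (fun w => 1 - w) '' Complex.slitPlane := by
      ext w
      exact ⟨fun h => ⟨1 - w, h, by ring⟩, by rintro ⟨v, hv, rfl⟩; simpa using hv⟩
    rw [h]
    exact (Complex.starConvex_one_slitPlane.isPathConnected
      Complex.one_mem_slitPlane).isConnected.isPreconnected.image _ (by fun_prop)
  refine hF.1.eqOn_of_preconnected_of_eventuallyEq hG.1 hpre (z₀ := 0) (by simp) ?_
  filter_upwards [Metric.ball_mem_nhds (0 : ℂ) one_pos] with w hw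
  have hw' : ‖w‖ < 1 := by simpa using hw
  rw [hF.2 w hw', hG.2 w hw']

/-- The regularized Gauss hypergeometric function `₂F₁(a, b; c; x) / Γ(c)` of real parameters at a
real point `x < 1`. -/
noncomputable def regularizedGaussReal (a b c x : ℝ) : ℝ :=
  (regularizedGauss a b c x).re

/-! ### The network model -/

section Model

variable {Ω : Type*} [MeasurableSpace Ω]

/-- The plane, with its Euclidean norm. -/
abbrev Plane : Type := EuclideanSpace ℝ (Fin 2)

/-- The number of points of the sequence `x` that lie in the set `B`. -/
noncomputable def pointCount (x : ℕ → Ω → Plane) (B : Set Plane) (ω : Ω) : ℕ∞ :=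
  {i : ℕ | x i ω ∈ B}.encard

/-- The random points `x 0, x 1, …` enumerate a stationary planar Poisson point process of
density `lam`: the number of points in a Borel set `B` of finite area is Poisson distributed with
mean `lam * area B`, and the numbers of points in disjoint Borel sets are independent. -/
structure IsPlanarPoissonProcess (P : Measure Ω) (lam : ℝ) (x : ℕ → Ω → Plane) : Prop where
  measurable : ∀ i, Measurable (x i)
  hasLaw_count : ∀ B : Set Plane, MeasurableSet B → volume B ≠ ∞ →
    HasLaw (pointCount x B)
      ((poissonMeasure (lam * (volume B).toReal).toNNReal).map (Nat.cast : ℕ → ℕ∞)) P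
  indep_count : ∀ (n : ℕ) (B : Fin n → Set Plane), (∀ j, MeasurableSet (B j)) →
    Pairwise (fun i j => Disjoint (B i) (B j)) → iIndepFun (fun j => pointCount x (B j)) P

/-- The random elements of the model with `N` receive antennas: the interferer locations `x i` form
a planar Poisson point process of density `lam`; the power fading gains `g n` of the desired link
to antenna `n` are Gamma distributed with shape `mD` and scale `1 / mD`; the power fading gains
`h n i` from interferer `i` to antenna `n` are Gamma distributed with shape `mI` and scale `1 / mI`;
all fading gains are mutually independent, and independent of the locations. -/
structure IsNakagamiPoissonModel (P : Measure Ω) (N : ℕ) (lam mD mI : ℝ)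
    (x : ℕ → Ω → Plane) (g : Fin N → Ω → ℝ) (h : Fin N → ℕ → Ω → ℝ) : Prop where
  poisson : IsPlanarPoissonProcess P lam x
  measurable_desired : ∀ n, Measurable (g n)
  measurable_interf : ∀ n i, Measurable (h n i)
  law_desired : ∀ n, HasLaw (g n) (gammaMeasure mD mD) P
  law_interf : ∀ n i, HasLaw (h n i) (gammaMeasure mI mI) P
  indep_fading :
    iIndepFun (Sum.elim g fun q : Fin N × ℕ => h q.1 q.2 : Fin N ⊕ (Fin N × ℕ) → Ω → ℝ) P
  indep_locations :
    IndepFun (fun ω i => x i ω) (fun ω => ((fun n => g n ω), fun n i => h n i ω)) P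

/-- The normalized interference power `d ^ α * ∑ i, h i * ‖x i‖ ^ (-α)` at one antenna, with values
in `[0, ∞]`. -/
noncomputable def interference (d α : ℝ) (x : ℕ → Ω → Plane) (h : ℕ → Ω → ℝ) (ω : Ω) : ℝ≥0∞ :=
  ENNReal.ofReal d ^ α * ∑' i, ENNReal.ofReal (h i ω) * ‖x i ω‖ₑ ^ (-α)

/-- The post-combiner signal-to-interference-plus-noise ratio
`∑ n, g n / (I n + SNR⁻¹)` of interference-aware maximal-ratio combining with `N` antennas. -/
noncomputable def sinrMRC {N : ℕ} (d α SNR : ℝ) (x : ℕ → Ω → Plane) (g : Fin N → Ω → ℝ)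
    (h : Fin N → ℕ → Ω → ℝ) (ω : Ω) : ℝ≥0∞ :=
  ∑ n, ENNReal.ofReal (g n ω) / (interference d α x (h n) ω + (ENNReal.ofReal SNR)⁻¹)

/-- The success probability `P(SINR ≥ T)` of maximal-ratio combining. -/
noncomputable def successProb (P : Measure Ω) {N : ℕ} (d α SNR T : ℝ) (x : ℕ → Ω → Plane)
    (g : Fin N → Ω → ℝ) (h : Fin N → ℕ → Ω → ℝ) : ℝ :=
  P.real {ω | ENNReal.ofReal T ≤ sinrMRC d α SNR x g h ω}

end Model

/-! ### The explicit formula -/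

/-- The function `𝒜(z, s, t)`. -/
noncomputable def calA (d α T mD mI z s t : ℝ) : ℝ :=
  if z < T then
    s ^ (2 / α) * (T - z) ^ (2 / α) * d ^ 2 * Real.Gamma (1 - 2 / α) * (mD / mI) ^ (2 / α) *
      Real.Gamma (2 / α + 2 * mI) *
      regularizedGaussReal (-(2 / α)) mI (2 * mI) (1 - z * t / ((T - z) * s))
  else
    (z * t) ^ (2 / α) * d ^ 2 * Real.Gamma (1 - 2 / α) * (mD / mI) ^ (2 / α) *
      (Real.Gamma (2 / α + mI) / Real.Gamma mI)

/-- The function of `(s, t)` that is differentiated in the formula. -/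
noncomputable def expTerm (lam d α SNR T mD mI z s t : ℝ) : ℝ :=
  Real.exp (-(max 0 (T - z) * s * mD / SNR) - z * t * mD / SNR
    - Real.pi * lam * calA d α T mD mI z s t)

/-- The mixed derivative `∂ᵏ/∂sᵏ ∂ᵐ/∂tᵐ f(s, t)` at `s = t = 1`. -/
noncomputable def mixedDeriv (k m : ℕ) (f : ℝ → ℝ → ℝ) : ℝ :=
  iteratedDeriv k (fun s => iteratedDeriv m (fun t => f s t) 1) 1

end DualBranchMRC

/-! Write `W₀`, `W₁` for the interference-plus-noise powers at the two antennas and condition on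
them. The second gain is independent of the first and has a Gamma density; substituting `g₁ = W₁ z`
makes `z` the contribution of antenna 1 to the SINR, and success becomes `g₀ ≥ (T - z)⁺ W₀`. Since
`mD` is an integer, this Gamma tail is a finite Poisson sum. With `X = (T - z)⁺ W₀ mD` and `Y = z W₁
mD` the conditional probability is the sum over `k < mD` of `1 / (k! Γ(mD)) ∫ z⁻¹ X ^ k Y ^ mD exp
(-X - Y) dz` (`gammaMeasure_prod_setOf_le`). Averaging over the interference leaves the moments `E[X
^ k Y ^ mD exp (-X - Y)]`, which up to sign are mixed derivatives at `(1, 1)` of `E[exp (-s X - t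
Y)]` (`mixedDeriv_eq_integral`).

It remains to recognise this joint Laplace transform as `E_z(s, t)` (`expTerm_eq_integral`). Both
antennas see the same interferers, so the two powers are treated together. The Laplace functional of
the marked Poisson process reduces the transform to a planar integral of `1 - exp (-c ‖y‖ ^ (-α))`,
equal to `π Γ(1 - 2/α) c ^ (2/α)`. What is left is the fractional moment of order `2/α` of a
weighted sum of two Gamma variables; splitting the sum into its total and a proportion turns the
moment into Euler's integral for the regularized Gauss function.

All probabilistic identities are proved in `[0, ∞]` with `exp (-∞) = 0`, so finiteness of the
interference is not assumed; it is read off from the Laplace transform near zero. Absolute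
convergence is also free: the summands are nonnegative and add up to a probability. -/

namespace DualBranchMRC

/-! ### The exponential on `[0, ∞]` and the Poisson generating function. -/

/-- The function `y ↦ exp (-y)` on `[0, ∞]`. -/
noncomputable def expNeg (y : ℝ≥0∞) : ℝ≥0∞ := EReal.exp (-(y : EReal))

theorem expNeg_zero : expNeg 0 = 1 := by simp [expNeg]

theorem expNeg_top : expNeg ∞ = 0 := by simp [expNeg]

theorem expNeg_ofReal {r : ℝ} (hr : 0 ≤ r) :
    expNeg (ENNReal.ofReal r) = ENNReal.ofReal (Real.exp (-r)) := by
  rw [expNeg, EReal.coe_ennreal_ofReal, max_eq_left hr, ← EReal.coe_neg, EReal.exp_coe]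

theorem expNeg_add (x y : ℝ≥0∞) : expNeg (x + y) = expNeg x * expNeg y := by
  rw [expNeg, EReal.coe_ennreal_add, EReal.neg_add (by simp) (by simp), sub_eq_add_neg,
    EReal.exp_add, expNeg, expNeg]

theorem expNeg_sum {ι : Type*} (s : Finset ι) (f : ι → ℝ≥0∞) :
    expNeg (∑ i ∈ s, f i) = ∏ i ∈ s, expNeg (f i) := by
  classical
  induction s using Finset.induction_on with
  | empty => simp [expNeg_zero]
  | insert i s hi ih => rw [Finset.sum_insert hi, Finset.prod_insert hi, expNeg_add, ih]

theorem expNeg_nat_mul (n : ℕ) (c : ℝ≥0∞) : expNeg (c * n) = expNeg c ^ n := by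
  have := expNeg_sum (Finset.range n) fun _ => c
  simpa [mul_comm] using this

theorem expNeg_antitone : Antitone expNeg := fun x y hxy => by
  rw [expNeg, expNeg, EReal.exp_le_exp_iff, EReal.neg_le_neg_iff]
  exact_mod_cast hxy

theorem expNeg_le_one (x : ℝ≥0∞) : expNeg x ≤ 1 := by
  rw [← expNeg_zero]
  exact expNeg_antitone bot_le

theorem expNeg_ne_top (x : ℝ≥0∞) : expNeg x ≠ ∞ :=
  ((expNeg_le_one x).trans_lt ENNReal.one_lt_top).ne

theorem continuous_expNeg : Continuous expNeg :=
  ENNReal.continuous_exp.comp (continuous_neg.comp continuous_coe_ennreal_ereal)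

@[fun_prop]
theorem measurable_expNeg : Measurable expNeg := continuous_expNeg.measurable

/-- Every number in `[0, 1]`, including `0`, has a negative logarithm in `[0, ∞]`. This lets a
mark-averaged factor be absorbed into a test function of the points. -/
theorem exists_expNeg_eq {φ : ℝ≥0∞} (hφ : φ ≤ 1) : expNeg (-ENNReal.log φ).toENNReal = φ := by
  rw [expNeg, EReal.coe_toENNReal, neg_neg, ENNReal.exp_log]
  rw [← EReal.neg_le_neg_iff]
  simpa [ENNReal.log_le_zero_iff] using hφ

/-- This is the Poisson generating function at `q = exp (-c)`, that is, the exponential series of `r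
q`. The value `c = ∞` is allowed and gives the probability of no point. -/
theorem lintegral_expNeg_poissonMeasure (r : NNReal) (c : ℝ≥0∞) :
    ∫⁻ n : ℕ, expNeg (c * n) ∂(poissonMeasure r) = expNeg (r * (1 - expNeg c)) := by
  set q := (expNeg c).toReal with hq
  have hq0 : 0 ≤ q := ENNReal.toReal_nonneg
  have hqe : expNeg c = ENNReal.ofReal q := (ENNReal.ofReal_toReal (expNeg_ne_top c)).symm
  have hq1 : q ≤ 1 := by
    have := expNeg_le_one c
    rw [hqe] at this
    simpa using this
  have h1 : (r : ℝ≥0∞) * (1 - expNeg c) = ENNReal.ofReal (r * (1 - q)) := by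
    rw [ENNReal.ofReal_mul r.coe_nonneg, ENNReal.ofReal_coe_nnreal, ENNReal.ofReal_sub _ hq0, hqe,
      ENNReal.ofReal_one]
  rw [h1, expNeg_ofReal (mul_nonneg r.coe_nonneg (by linarith)), poissonMeasure,
    lintegral_sum_measure]
  simp_rw [lintegral_smul_measure, lintegral_dirac, expNeg_nat_mul, hqe, ← ENNReal.ofReal_pow hq0,
    smul_eq_mul]
  have h2 : HasSum (fun n : ℕ => Real.exp (-r) * r ^ n / n.factorial * q ^ n)
      (Real.exp (-(r * (1 - q)))) := by
    have := (NormedSpace.expSeries_div_hasSum_exp ((r : ℝ) * q)).mul_left (Real.exp (-r))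
    rw [← Real.exp_eq_exp_ℝ, ← Real.exp_add] at this
    convert! this using 1
    · ext n; rw [mul_pow]; ring
    · congr 1; ring
  rw [← h2.tsum_eq, ENNReal.ofReal_tsum_of_nonneg (fun n => by positivity) h2.summable]
  exact tsum_congr fun n => (ENNReal.ofReal_mul (by positivity)).symm

theorem tsum_indicator_pointCount {Ω : Type*} (x : ℕ → Ω → Plane) (B : Set Plane) (c : ℝ≥0∞) (ω : Ω) :
    ∑' i, B.indicator (fun _ => c) (x i ω) = c * (pointCount x B ω : ℝ≥0∞) := by
  have : ∀ i, B.indicator (fun _ => c) (x i ω) =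
      {i | x i ω ∈ B}.indicator (fun _ => c) i := fun i => by
    by_cases h : x i ω ∈ B <;> simp [h]
  simp_rw [this]
  rw [← tsum_subtype, pointCount, ENNReal.tsum_set_const, mul_comm]

/-! ### Laplace functional of the Poisson process. -/

section Poisson

variable {Ω : Type*} [MeasurableSpace Ω] {P : Measure Ω} {lam : ℝ} {x : ℕ → Ω → Plane}

theorem IsPlanarPoissonProcess.lintegral_expNeg_pointCount (hx : IsPlanarPoissonProcess P lam x)
    (hlam : 0 ≤ lam) {B : Set Plane} (hB : MeasurableSet B) (hB' : volume B ≠ ∞) (c : ℝ≥0∞) :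
    ∫⁻ ω, expNeg (c * (pointCount x B ω : ℝ≥0∞)) ∂P =
      expNeg (ENNReal.ofReal lam * volume B * (1 - expNeg c)) := by
  have hl := hx.hasLaw_count B hB hB'
  have hm : Measurable fun n : ℕ∞ => expNeg (c * (n : ℝ≥0∞)) := Measurable.of_discrete
  rw [← lintegral_map' (f := fun n : ℕ∞ => expNeg (c * (n : ℝ≥0∞))) hm.aemeasurable hl.aemeasurable,
    hl.map_eq, lintegral_map hm Measurable.of_discrete]
  have : ENNReal.ofReal lam * volume B = ((lam * (volume B).toReal).toNNReal : ℝ≥0∞) := by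
    rw [← ENNReal.ofReal_toReal hB', ← ENNReal.ofReal_mul hlam, ENNReal.toReal_ofReal
      ENNReal.toReal_nonneg]
    rfl
  rw [this, ← lintegral_expNeg_poissonMeasure]
  simp

theorem measurable_pointCount (hx : ∀ i, Measurable (x i)) {B : Set Plane}
    (hB : MeasurableSet B) : Measurable fun ω => (pointCount x B ω : ℝ≥0∞) := by
  have : ∀ ω, (pointCount x B ω : ℝ≥0∞) = ∑' i, B.indicator (fun _ => 1) (x i ω) := fun ω => by
    rw [tsum_indicator_pointCount, one_mul]
  simp_rw [this]
  exact Measurable.tsum fun i => (measurable_const.indicator hB).comp (hx i)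

/-- The sum over the points is a combination of the counts in the level sets. These sets are
disjoint, so the counts are independent and the Poisson transforms multiply. -/
theorem IsPlanarPoissonProcess.lintegral_expNeg_simpleFunc (hx : IsPlanarPoissonProcess P lam x)
    (hlam : 0 ≤ lam) (f : SimpleFunc Plane ℝ≥0∞) (hf : f.FinMeasSupp volume) :
    ∫⁻ ω, expNeg (∑' i, f (x i ω)) ∂P =
      expNeg (ENNReal.ofReal lam * ∫⁻ y, (1 - expNeg (f y))) := by
  classical
  -- The value `0` contributes nothing and is dropped because its level set has infinite area, where
  -- no Poisson law of the count is available.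
  set R := f.range.filter (· ≠ 0) with hR
  set n := R.card
  let e : R ≃ Fin n := R.equivFin
  let c : Fin n → ℝ≥0∞ := fun j => (e.symm j : ℝ≥0∞)
  let B : Fin n → Set Plane := fun j => f ⁻¹' {c j}
  have hsumR : ∀ g : ℝ≥0∞ → ℝ≥0∞, ∑ j, g (c j) = ∑ r ∈ R, g r := fun g => by
    rw [← Finset.sum_coe_sort R g]
    exact e.symm.sum_comp fun r : R => g r
  have hc0 : ∀ j, c j ≠ 0 := fun j => (Finset.mem_filter.1 (e.symm j).2).2
  have hBm : ∀ j, MeasurableSet (B j) := fun j => f.measurableSet_preimage _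
  have hBv : ∀ j, volume (B j) ≠ ∞ := fun j =>
    (SimpleFunc.finMeasSupp_iff.1 hf (c j) (hc0 j)).ne
  have hdisj : Pairwise fun i j => Disjoint (B i) (B j) := fun i j hij => by
    refine Disjoint.preimage _ (disjoint_singleton.2 fun h => hij ?_)
    exact e.symm.injective (Subtype.ext h)
  have hfB : ∀ y, f y = ∑ j, (B j).indicator (fun _ => c j) y := fun y => by
    have : ∀ j, (B j).indicator (fun _ => c j) y = if f y = c j then c j else 0 := fun j => by
      simp [indicator_apply, B]
    simp_rw [this]
    rw [hsumR fun r => if f y = r then r else 0]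
    by_cases h0 : f y = 0
    · simp [h0]
    · rw [Finset.sum_ite_eq, if_pos]
      exact Finset.mem_filter.2 ⟨f.mem_range_self y, h0⟩
  have h1 : ∀ ω, expNeg (∑' i, f (x i ω)) = ∏ j, expNeg (c j * (pointCount x (B j) ω : ℝ≥0∞)) :=
    fun ω => by
    simp_rw [hfB, ← expNeg_sum, ← tsum_indicator_pointCount]
    rw [Summable.tsum_finsetSum fun _ _ => ENNReal.summable]
  have hind : iIndepFun (fun j ω => expNeg (c j * (pointCount x (B j) ω : ℝ≥0∞))) P :=
    (hx.indep_count n B hBm hdisj).comp (fun j (k : ℕ∞) => expNeg (c j * (k : ℝ≥0∞)))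
      fun j => Measurable.of_discrete
  simp_rw [h1]
  rw [lintegral_prod_eq_prod_lintegral_of_indepFun _ _ hind fun j =>
    measurable_expNeg.comp ((measurable_pointCount hx.measurable (hBm j)).const_mul _)]
  simp_rw [fun j => hx.lintegral_expNeg_pointCount hlam (hBm j) (hBv j) (c j)]
  rw [← expNeg_sum]
  have h2 : ∫⁻ y, (1 - expNeg (f y)) = ∑ r ∈ R, (1 - expNeg r) * volume (f ⁻¹' {r}) := by
    have := SimpleFunc.map_lintegral (μ := volume) (fun r => 1 - expNeg r) f
    rw [← SimpleFunc.lintegral_eq_lintegral] at this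
    simp only [SimpleFunc.map_apply] at this
    rw [this, hR, Finset.sum_filter_of_ne]
    intro r _ hr h0
    simp [h0, expNeg_zero] at hr
  rw [h2, ← hsumR fun r => (1 - expNeg r) * volume (f ⁻¹' {r}), Finset.mul_sum]
  congr 1
  exact Finset.sum_congr rfl fun j _ => by ring

theorem measurable_one_sub_expNeg : Measurable fun y => 1 - expNeg y :=
  measurable_const.sub measurable_expNeg

/-- The Laplace functional of a planar Poisson process. -/
theorem IsPlanarPoissonProcess.lintegral_expNeg_tsum [IsProbabilityMeasure P]
    (hx : IsPlanarPoissonProcess P lam x) (hlam : 0 ≤ lam) {f : Plane → ℝ≥0∞} (hf : Measurable f) :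
    ∫⁻ ω, expNeg (∑' i, f (x i ω)) ∂P =
      expNeg (ENNReal.ofReal lam * ∫⁻ y, (1 - expNeg (f y))) := by
  -- Cutting off to growing balls gives the approximants support of finite area and keeps them
  -- increasing.
  let F : ℕ → SimpleFunc Plane ℝ≥0∞ := fun n =>
    (SimpleFunc.eapprox f n).restrict (Metric.closedBall 0 n)
  have hFa : ∀ n y, F n y = (Metric.closedBall (0 : Plane) n).indicator (SimpleFunc.eapprox f n) y :=
    fun n y => by rw [SimpleFunc.restrict_apply _ measurableSet_closedBall]
  have hFfin : ∀ n, (F n).FinMeasSupp volume := fun n => by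
    rw [SimpleFunc.finMeasSupp_iff]
    intro r hr
    refine lt_of_le_of_lt (measure_mono fun y hy => ?_)
      (measure_closedBall_lt_top (x := (0 : Plane)) (r := n))
    by_contra hy'
    rw [mem_preimage, hFa, indicator_of_notMem hy'] at hy
    exact hr hy.symm
  have hmono : ∀ y, Monotone fun n => F n y := fun y n m hnm => by
    beta_reduce
    rw [hFa, hFa]
    refine (indicator_le_indicator (SimpleFunc.monotone_eapprox f hnm y)).trans ?_
    refine indicator_le_indicator_of_subset (Metric.closedBall_subset_closedBall ?_)
      (fun _ => zero_le) y
    exact_mod_cast hnm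
  have hlim : ∀ y, Tendsto (fun n => F n y) atTop (𝓝 (f y)) := fun y => by
    have h1 : Tendsto (fun n => SimpleFunc.eapprox f n y) atTop (𝓝 (f y)) := by
      rw [← SimpleFunc.iSup_eapprox_apply hf y]
      exact tendsto_atTop_iSup fun n m hnm => SimpleFunc.monotone_eapprox f hnm y
    refine h1.congr' ?_
    obtain ⟨N, hN⟩ := exists_nat_ge ‖y‖
    filter_upwards [eventually_ge_atTop N] with n hn
    rw [hFa, indicator_of_mem]
    rw [mem_closedBall_zero_iff]
    exact hN.trans (by exact_mod_cast hn)
  -- Monotone convergence for counting measure on the indices.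
  have hsum : ∀ ω, Tendsto (fun n => ∑' i, F n (x i ω)) atTop (𝓝 (∑' i, f (x i ω))) := fun ω => by
    simp_rw [← lintegral_count]
    exact lintegral_tendsto_of_tendsto_of_monotone (fun n => Measurable.of_discrete.aemeasurable)
      (ae_of_all _ fun i => hmono _) (ae_of_all _ fun i => hlim _)
  have hL : Tendsto (fun n => ∫⁻ ω, expNeg (∑' i, F n (x i ω)) ∂P) atTop
      (𝓝 (∫⁻ ω, expNeg (∑' i, f (x i ω)) ∂P)) := by
    refine tendsto_lintegral_of_dominated_convergence (fun _ => 1) (fun n => ?_)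
      (fun n => ae_of_all _ fun ω => expNeg_le_one _) (by simp) (ae_of_all _ fun ω => ?_)
    · exact measurable_expNeg.comp (Measurable.tsum fun i =>
        (F n).measurable.comp (hx.measurable i))
    · exact (continuous_expNeg.tendsto _).comp (hsum ω)
  have hRI : Tendsto (fun n => ∫⁻ y, (1 - expNeg (F n y))) atTop
      (𝓝 (∫⁻ y, (1 - expNeg (f y)))) := by
    refine lintegral_tendsto_of_tendsto_of_monotone (fun n =>
      (measurable_one_sub_expNeg.comp (F n).measurable).aemeasurable)
      (ae_of_all _ fun y n m hnm => tsub_le_tsub_left (expNeg_antitone (hmono y hnm)) _)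
      (ae_of_all _ fun y => ?_)
    exact ENNReal.Tendsto.sub tendsto_const_nhds ((continuous_expNeg.tendsto _).comp (hlim y))
      (Or.inl ENNReal.one_ne_top)
  have hR := (continuous_expNeg.tendsto _).comp
    (ENNReal.Tendsto.const_mul hRI (Or.inr (ENNReal.ofReal_ne_top (r := lam))))
  refine tendsto_nhds_unique hL (hR.congr fun n => ?_)
  exact (hx.lintegral_expNeg_simpleFunc hlam (F n) (hFfin n)).symm

end Poisson

/-! ### Independent fading marks attached to the points. -/

section Marks

variable {Ω : Type*} [MeasurableSpace Ω] {P : Measure Ω} {lam : ℝ} {x : ℕ → Ω → Plane}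

/-- The points are frozen here, so only `r i` remembers them. Independence factorizes the
expectation for finitely many points, and dominated convergence with bound `1` passes to all of
them. -/
theorem lintegral_expNeg_tsum_marks [IsProbabilityMeasure P] {N : ℕ} {H : Fin N × ℕ → Ω → ℝ}
    {ν : Measure ℝ} (hH : ∀ q, Measurable (H q)) (hlaw : ∀ q, HasLaw (H q) ν P)
    (hind : iIndepFun H P) (a : Fin N → ℝ≥0∞) (r f : ℕ → ℝ≥0∞)
    (hf : ∀ i, expNeg (f i) = ∏ n, ∫⁻ u, expNeg (a n * ENNReal.ofReal u * r i) ∂ν) :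
    ∫⁻ ω, expNeg (∑' i, (∑ n, a n * ENNReal.ofReal (H (n, i) ω)) * r i) ∂P =
      expNeg (∑' i, f i) := by
  have hm : ∀ q : Fin N × ℕ, Measurable fun u : ℝ => expNeg (a q.1 * ENNReal.ofReal u * r q.2) :=
    fun q => by fun_prop
  have hfin : ∀ k, ∫⁻ ω, expNeg (∑ i ∈ Finset.range k,
      (∑ n, a n * ENNReal.ofReal (H (n, i) ω)) * r i) ∂P = expNeg (∑ i ∈ Finset.range k, f i) := by
    intro k
    have h1 : ∀ ω, expNeg (∑ i ∈ Finset.range k, (∑ n, a n * ENNReal.ofReal (H (n, i) ω)) * r i) =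
        ∏ q ∈ Finset.univ ×ˢ Finset.range k,
          expNeg (a q.1 * ENNReal.ofReal (H q ω) * r q.2) := fun ω => by
      rw [Finset.prod_product_right, expNeg_sum]
      exact Finset.prod_congr rfl fun i _ => by rw [Finset.sum_mul, expNeg_sum]
    simp_rw [h1]
    have h2 := lintegral_prod_eq_prod_lintegral_of_indepFun (Finset.univ ×ˢ Finset.range k) _
      (hind.comp (fun q u => expNeg (a q.1 * ENNReal.ofReal u * r q.2)) hm)
      fun q => (hm q).comp (hH q)
    simp only [Function.comp_apply] at h2
    rw [h2, Finset.prod_product_right, expNeg_sum]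
    refine Finset.prod_congr rfl fun i _ => ?_
    rw [hf]
    refine Finset.prod_congr rfl fun n _ => ?_
    rw [← (hlaw (n, i)).map_eq, lintegral_map (hm (n, i)) (hH _)]
  have hL : Tendsto (fun k => ∫⁻ ω, expNeg (∑ i ∈ Finset.range k,
      (∑ n, a n * ENNReal.ofReal (H (n, i) ω)) * r i) ∂P) atTop
      (𝓝 (∫⁻ ω, expNeg (∑' i, (∑ n, a n * ENNReal.ofReal (H (n, i) ω)) * r i) ∂P)) := by
    refine tendsto_lintegral_of_dominated_convergence (fun _ => 1) (fun n => by fun_prop)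
      (fun n => ae_of_all _ fun ω => expNeg_le_one _) (by simp) (ae_of_all _ fun ω => ?_)
    exact (continuous_expNeg.tendsto _).comp ENNReal.summable.hasSum.tendsto_sum_nat
  refine tendsto_nhds_unique hL ?_
  simp_rw [hfin]
  exact (continuous_expNeg.tendsto _).comp ENNReal.summable.hasSum.tendsto_sum_nat

/-- The Laplace functional of a Poisson process with independent marks. -/
theorem IsPlanarPoissonProcess.lintegral_expNeg_marks [IsProbabilityMeasure P]
    (hx : IsPlanarPoissonProcess P lam x) (hlam : 0 ≤ lam) {N : ℕ} {H : Fin N × ℕ → Ω → ℝ}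
    {ν : Measure ℝ} [IsProbabilityMeasure ν] (hH : ∀ q, Measurable (H q))
    (hlaw : ∀ q, HasLaw (H q) ν P) (hind : iIndepFun H P)
    (hindx : IndepFun (fun ω i => x i ω) (fun ω q => H q ω) P) (a : Fin N → ℝ≥0∞)
    {l : Plane → ℝ≥0∞} (hl : Measurable l) :
    ∫⁻ ω, expNeg (∑' i, (∑ n, a n * ENNReal.ofReal (H (n, i) ω)) * l (x i ω)) ∂P =
      expNeg (ENNReal.ofReal lam *
        ∫⁻ y, (1 - ∏ n, ∫⁻ u, expNeg (a n * ENNReal.ofReal u * l y) ∂ν)) := by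
  set φ : Plane → ℝ≥0∞ := fun y => ∏ n, ∫⁻ u, expNeg (a n * ENNReal.ofReal u * l y) ∂ν with hφ
  have hφ1 : ∀ y, φ y ≤ 1 := fun y => by
    refine Finset.prod_le_one' fun n _ => ?_
    calc _ ≤ ∫⁻ _, 1 ∂ν := lintegral_mono fun u => expNeg_le_one _
      _ = 1 := by simp
  have hφm : Measurable φ := by
    refine Finset.measurable_prod _ fun n _ => ?_
    exact Measurable.lintegral_prod_right' (f := fun p : Plane × ℝ =>
      expNeg (a n * ENNReal.ofReal p.2 * l p.1)) (by fun_prop)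
  -- Averaging the marks at a point `y` multiplies by `φ y = exp (-f y)`. The marked functional is
  -- thus the unmarked one evaluated at `f`, and no marking theorem is needed.
  set f : Plane → ℝ≥0∞ := fun y => (-ENNReal.log (φ y)).toENNReal with hf
  have hfm : Measurable f :=
    (continuous_neg.measurable.comp hφm.ennreal_log).ereal_toENNReal
  have hfφ : ∀ y, expNeg (f y) = φ y := fun y => exists_expNeg_eq (hφ1 y)
  change _ = expNeg (ENNReal.ofReal lam * ∫⁻ y, (1 - φ y))
  simp_rw [← hfφ]
  rw [← hx.lintegral_expNeg_tsum hlam hfm]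
  have hxm : Measurable fun ω i => x i ω := measurable_pi_iff.2 hx.measurable
  have hHm : Measurable fun ω q => H q ω := measurable_pi_iff.2 hH
  have hprod := (indepFun_iff_map_prod_eq_prod_map_map hxm.aemeasurable hHm.aemeasurable).1 hindx
  have hG : Measurable fun p : (ℕ → Plane) × (Fin N × ℕ → ℝ) =>
      expNeg (∑' i, (∑ n, a n * ENNReal.ofReal (p.2 (n, i))) * l (p.1 i)) := by
    fun_prop
  have := Measure.isProbabilityMeasure_map (μ := P) hxm.aemeasurable
  have := Measure.isProbabilityMeasure_map (μ := P) hHm.aemeasurable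
  calc _ = ∫⁻ p, expNeg (∑' i, (∑ n, a n * ENNReal.ofReal (p.2 (n, i))) * l (p.1 i))
        ∂(P.map fun ω => ((fun i => x i ω), fun q => H q ω)) := by
        rw [lintegral_map hG (hxm.prodMk hHm)]
    _ = ∫⁻ xs, expNeg (∑' i, f (xs i)) ∂(P.map fun ω i => x i ω) := by
        rw [hprod, lintegral_prod _ hG.aemeasurable]
        refine lintegral_congr fun xs => ?_
        rw [lintegral_map (by fun_prop) hHm]
        exact lintegral_expNeg_tsum_marks hH hlaw hind a (fun i => l (xs i)) (fun i => f (xs i))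
          fun i => hfφ _
    _ = _ := by
        rw [lintegral_map (by fun_prop) hxm]

end Marks

/-! ### The planar integral of the power-law path loss. -/

theorem lintegral_Ioi_exp_neg {u : ℝ} :
    ∫⁻ v in Ioi u, ENNReal.ofReal (Real.exp (-v)) = ENNReal.ofReal (Real.exp (-u)) := by
  rw [← integral_exp_neg_Ioi u, ofReal_integral_eq_lintegral_ofReal (integrableOn_exp_neg_Ioi u)
    (ae_of_all _ fun v => (Real.exp_pos _).le)]

/-- Layer-cake form of `1 - exp (-u) = ∫₀ᵘ exp (-v) dv`, valid also at `u = ∞`. By Tonelli,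
integrating over the plane then requires only the areas of superlevel sets. -/
theorem one_sub_expNeg_eq_lintegral (u : ℝ≥0∞) :
    1 - expNeg u = ∫⁻ v in Ioi (0 : ℝ), {v : ℝ | ENNReal.ofReal v < u}.indicator
      (fun v => ENNReal.ofReal (Real.exp (-v))) v := by
  have h1 : ∫⁻ v in Ioi (0 : ℝ), ENNReal.ofReal (Real.exp (-v)) = 1 := by
    simp [lintegral_Ioi_exp_neg]
  have hm : MeasurableSet {v : ℝ | ENNReal.ofReal v < u} :=
    measurableSet_lt ENNReal.measurable_ofReal measurable_const
  have h2 : ∫⁻ v in Ioi (0 : ℝ), {v : ℝ | ENNReal.ofReal v < u}ᶜ.indicator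
      (fun v => ENNReal.ofReal (Real.exp (-v))) v = expNeg u := by
    rw [lintegral_indicator hm.compl, Measure.restrict_restrict hm.compl]
    induction u with
    | top => simp [expNeg_top]
    | coe u =>
      have : ({v : ℝ | ENNReal.ofReal v < u}ᶜ ∩ Ioi 0 : Set ℝ) =ᵐ[volume] Ioi (u : ℝ) := by
        have h3 : ({v : ℝ | ENNReal.ofReal v < u}ᶜ ∩ Ioi 0 : Set ℝ) = Ici (u : ℝ) ∩ Ioi 0 := by
          ext v
          simp only [mem_inter_iff, mem_compl_iff, mem_ofPred_eq, not_lt, mem_Ioi, mem_Ici,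
            and_congr_left_iff]
          intro hv
          rw [← ENNReal.ofReal_coe_nnreal, ENNReal.ofReal_le_ofReal_iff hv.le]
        have h4 : (Ioi (u : ℝ)) = Ioi (u : ℝ) ∩ Ioi 0 := by
          rw [inter_eq_left.2]
          exact Ioi_subset_Ioi u.coe_nonneg
        rw [h3, h4]
        exact Ioi_ae_eq_Ici.symm.inter (ae_eq_refl _)
      rw [setLIntegral_congr this, lintegral_Ioi_exp_neg, ← expNeg_ofReal u.coe_nonneg,
        ENNReal.ofReal_coe_nnreal]
  refine (ENNReal.sub_eq_of_eq_add (expNeg_ne_top u) ?_)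
  rw [← h2, ← h1, ← lintegral_add_left]
  · exact lintegral_congr fun v => by
      by_cases hv : ENNReal.ofReal v < u <;> simp [hv, indicator]
  · exact Measurable.indicator (by fun_prop) hm

theorem setOf_lt_mul_enorm_rpow {α : ℝ} (hα : 0 < α) {c v : ℝ} (hc : 0 ≤ c) (hv : 0 < v) :
    {y : Plane | ENNReal.ofReal v < ENNReal.ofReal c * ‖y‖ₑ ^ (-α)} =
      Metric.ball 0 ((c / v) ^ α⁻¹) := by
  ext y
  rcases hc.eq_or_lt with rfl | hc
  · simp [Real.zero_rpow (inv_ne_zero hα.ne')]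
  have hr : 0 < (c / v) ^ α⁻¹ := by positivity
  rw [mem_ofPred_eq, mem_ball_zero_iff]
  by_cases hy : y = 0
  · simp [hy, hα, hr, ENNReal.mul_top, hc]
  have hy' : 0 < ‖y‖ := norm_pos_iff.2 hy
  rw [← ofReal_norm, ENNReal.ofReal_rpow_of_pos hy', ← ENNReal.ofReal_mul hc.le,
    ENNReal.ofReal_lt_ofReal_iff (by positivity), Real.rpow_neg hy'.le, ← div_eq_mul_inv,
    lt_div_iff₀ (by positivity), ← lt_div_iff₀' hv, Real.lt_rpow_inv_iff_of_pos hy'.le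
      (by positivity) hα]

theorem lintegral_Ioi_rpow_mul_exp_neg {s r : ℝ} (hs : 0 < s) (hr : 0 < r) :
    ∫⁻ v in Ioi (0 : ℝ), ENNReal.ofReal (v ^ (s - 1) * Real.exp (-(r * v))) =
      ENNReal.ofReal ((1 / r) ^ s * Real.Gamma s) := by
  have h := Real.integral_rpow_mul_exp_neg_mul_Ioi hs hr
  rw [← h, ofReal_integral_eq_lintegral_ofReal]
  -- A nonzero Bochner integral certifies integrability, since the default value is `0`.
  · refine (not_imp_comm.1 integral_undef ?_)
    rw [h]
    have := Real.Gamma_pos_of_pos hs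
    positivity
  · filter_upwards [ae_restrict_mem measurableSet_Ioi] with v hv
    have : 0 < v := hv
    positivity

/-- The superlevel set at height `v` is a disc of area `π (C / v) ^ (2 / α)`. Integrating `v ^
(-2/α) exp (-v)` gives `Γ(1 - 2/α)`, which converges because `α > 2`. -/
theorem lintegral_one_sub_expNeg_pathLoss {α : ℝ} (hα : 2 < α) {c : ℝ≥0∞} (hc : c ≠ ∞) :
    ∫⁻ y : Plane, (1 - expNeg (c * ‖y‖ₑ ^ (-α))) =
      ENNReal.ofReal (Real.pi * Real.Gamma (1 - 2 / α)) * c ^ (2 / α) := by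
  have hδ : 0 < 2 / α := by positivity
  have hδ1 : 0 < 1 - 2 / α := by
    rw [sub_pos, div_lt_one (by linarith)]
    exact hα
  obtain ⟨C, hC0, rfl⟩ : ∃ C : ℝ, 0 ≤ C ∧ c = ENNReal.ofReal C :=
    ⟨c.toReal, ENNReal.toReal_nonneg, (ENNReal.ofReal_toReal hc).symm⟩
  have hset : MeasurableSet {p : Plane × ℝ |
      ENNReal.ofReal p.2 < ENNReal.ofReal C * ‖p.1‖ₑ ^ (-α)} :=
    measurableSet_lt (by fun_prop) (by fun_prop)
  simp_rw [one_sub_expNeg_eq_lintegral]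
  rw [lintegral_lintegral_swap]
  · have hin : ∀ v ∈ Ioi (0 : ℝ), (∫⁻ y : Plane, {v : ℝ | ENNReal.ofReal v <
        ENNReal.ofReal C * ‖y‖ₑ ^ (-α)}.indicator (fun v => ENNReal.ofReal (Real.exp (-v))) v) =
        ENNReal.ofReal (Real.pi * C ^ (2 / α)) *
          ENNReal.ofReal (v ^ ((1 - 2 / α) - 1) * Real.exp (-(1 * v))) := by
      intro v hv
      have hv0 : 0 < v := hv
      have : ∀ y : Plane, {v : ℝ | ENNReal.ofReal v <
        ENNReal.ofReal C * ‖y‖ₑ ^ (-α)}.indicator (fun v => ENNReal.ofReal (Real.exp (-v))) v =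
        (Metric.ball (0 : Plane) ((C / v) ^ α⁻¹)).indicator
          (fun _ => ENNReal.ofReal (Real.exp (-v))) y := fun y => by
        rw [← setOf_lt_mul_enorm_rpow (by linarith) hC0 hv0]
        simp [indicator]
      simp_rw [this]
      rw [lintegral_indicator_const Metric.isOpen_ball.measurableSet,
        EuclideanSpace.volume_ball_fin_two, ← ENNReal.ofReal_pow (by positivity),
        ← ENNReal.ofReal_mul (by positivity), ← ENNReal.ofReal_mul (by positivity),
        ← ENNReal.ofReal_mul (by positivity)]
      congr 1
      have h1 : ((C / v) ^ α⁻¹) ^ 2 = C ^ (2 / α) * v ^ ((1 - 2 / α) - 1) := by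
        rw [← Real.rpow_natCast, ← Real.rpow_mul (by positivity), Real.div_rpow hC0 hv0.le,
          show (1 - 2 / α) - 1 = -(2 / α) by ring, Real.rpow_neg hv0.le, div_eq_mul_inv]
        rw [show α⁻¹ * ((2 : ℕ) : ℝ) = 2 / α by push_cast; ring]
      rw [h1, one_mul]
      ring
    rw [setLIntegral_congr_fun measurableSet_Ioi hin, lintegral_const_mul _ (by fun_prop),
      lintegral_Ioi_rpow_mul_exp_neg hδ1 one_pos, ENNReal.ofReal_rpow_of_nonneg hC0 hδ.le,
      ← ENNReal.ofReal_mul (by positivity), ← ENNReal.ofReal_mul]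
    · congr 1
      rw [div_one, Real.one_rpow]
      ring
    · have := Real.Gamma_pos_of_pos hδ1
      positivity
  · refine Measurable.aemeasurable ?_
    have : (Function.uncurry fun (y : Plane) (v : ℝ) => {v : ℝ | ENNReal.ofReal v <
        ENNReal.ofReal C * ‖y‖ₑ ^ (-α)}.indicator (fun v => ENNReal.ofReal (Real.exp (-v))) v) =
        {p : Plane × ℝ | ENNReal.ofReal p.2 < ENNReal.ofReal C * ‖p.1‖ₑ ^ (-α)}.indicator
          fun p => ENNReal.ofReal (Real.exp (-p.2)) := by
      ext p
      simp [Function.uncurry, indicator]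
    rw [this]
    exact Measurable.indicator (by fun_prop) hset

/-! ### Euler's integral for the regularized Gauss function. -/

theorem integrableOn_gaussWeight {b c : ℂ} (hb : 0 < b.re) (hbc : b.re < c.re) :
    IntegrableOn (gaussWeight b c) (Ioc 0 1) := by
  have := Complex.betaIntegral_convergent hb (v := c - b) (by simpa using hbc)
  rwa [intervalIntegrable_iff_integrableOn_Ioc_of_le zero_le_one] at this

theorem continuousOn_euler_kernel (a : ℂ) {w : ℂ} (hw : 1 - w ∈ Complex.slitPlane) :
    ContinuousOn (fun u : ℝ => (1 - (u : ℂ) * w) ^ (-a)) (Icc 0 1) := fun u hu =>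
  ContinuousAt.continuousWithinAt (ContinuousAt.cpow (by fun_prop) (by fun_prop)
    (kernel_mem_slitPlane hw hu))

theorem integrableOn_gaussWeight_mul_euler_kernel (a : ℂ) {b c : ℂ} (hb : 0 < b.re)
    (hbc : b.re < c.re) {w : ℂ} (hw : 1 - w ∈ Complex.slitPlane) :
    IntegrableOn (fun u : ℝ => gaussWeight b c u * (1 - (u : ℂ) * w) ^ (-a)) (Ioc 0 1) := by
  obtain ⟨C, hC⟩ := isCompact_Icc.exists_bound_of_continuousOn (continuousOn_euler_kernel a hw)
  refine (integrableOn_gaussWeight hb hbc).mul_bdd (c := C)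
    (((continuousOn_euler_kernel a hw).mono Ioc_subset_Icc_self).aestronglyMeasurable
      measurableSet_Ioc) ?_
  filter_upwards [ae_restrict_mem measurableSet_Ioc] with u hu
  exact hC u (Ioc_subset_Icc_self hu)

/-- Euler's integral is the principal branch of the regularized Gauss function. -/
theorem isGaussContinuation_eulerIntegral (a b c : ℂ) (hb : 0 < b.re) (hbc : b.re < c.re) :
    IsGaussContinuation a b c fun w => (Complex.Gamma b * Complex.Gamma (c - b))⁻¹ *
      ∫ u in Ioc (0 : ℝ) 1, gaussWeight b c u * (1 - (u : ℂ) * w) ^ (-a) := by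
  have hcb : 0 < (c - b).re := by simpa using hbc
  have hφ := integrableOn_gaussWeight hb hbc
  have hU : IsOpen {w : ℂ | 1 - w ∈ Complex.slitPlane} :=
    Complex.isOpen_slitPlane.preimage (by fun_prop)
  have hKm : ∀ a : ℂ, ∀ w, 1 - w ∈ Complex.slitPlane → AEStronglyMeasurable
      (fun u : ℝ => (1 - (u : ℂ) * w) ^ (-a)) (volume.restrict (Ioc 0 1)) := fun a w hw =>
    ((continuousOn_euler_kernel a hw).mono Ioc_subset_Icc_self).aestronglyMeasurable
      measurableSet_Ioc
  have hKi : ∀ a : ℂ, ∀ w, 1 - w ∈ Complex.slitPlane → IntegrableOn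
      (fun u : ℝ => gaussWeight b c u * (1 - (u : ℂ) * w) ^ (-a)) (Ioc 0 1) :=
    fun a w hw => integrableOn_gaussWeight_mul_euler_kernel a hb hbc hw
  refine ⟨?_, ?_⟩
  · refine DifferentiableOn.analyticOnNhd (fun w₀ hw₀ => ?_) hU
    refine DifferentiableAt.differentiableWithinAt (DifferentiableAt.const_mul ?_ _)
    obtain ⟨r, hr, hrU⟩ := Metric.nhds_basis_closedBall.mem_iff.1 (hU.mem_nhds hw₀)
    have hcont : ContinuousOn
        (fun p : ℂ × ℝ => -a * (1 - (p.2 : ℂ) * p.1) ^ (-a - 1) * -(p.2 : ℂ))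
        (Metric.closedBall w₀ r ×ˢ Icc (0 : ℝ) 1) := by
      have h0 : ContinuousOn (fun p : ℂ × ℝ => (1 - (p.2 : ℂ) * p.1) ^ (-a - 1))
          (Metric.closedBall w₀ r ×ˢ Icc (0 : ℝ) 1) := by
        refine ContinuousOn.cpow ?_ continuousOn_const fun p hp =>
          kernel_mem_slitPlane (hrU hp.1) hp.2
        fun_prop
      have h1 : ContinuousOn (fun p : ℂ × ℝ => -(p.2 : ℂ))
          (Metric.closedBall w₀ r ×ˢ Icc (0 : ℝ) 1) := by fun_prop
      exact (continuousOn_const.mul h0).mul h1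
    obtain ⟨C, hC⟩ := ((isCompact_closedBall w₀ r).prod isCompact_Icc).exists_bound_of_continuousOn
      hcont
    have := hasDerivAt_integral_of_dominated_loc_of_deriv_le
      (μ := volume.restrict (Ioc (0 : ℝ) 1)) (s := Metric.closedBall w₀ r) (x₀ := w₀)
      (F := fun w u => gaussWeight b c u * (1 - (u : ℂ) * w) ^ (-a))
      (F' := fun w u => gaussWeight b c u * (-a * (1 - (u : ℂ) * w) ^ (-a - 1) * -(u : ℂ)))
      (bound := fun u => ‖gaussWeight b c u‖ * C)
      (Metric.closedBall_mem_nhds _ hr)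
      (by
        filter_upwards [hU.mem_nhds hw₀] with w hw
        exact (hKi a w hw).aestronglyMeasurable)
      (hKi a w₀ hw₀)
      (by
        refine hφ.aestronglyMeasurable.mul (AEStronglyMeasurable.mul ?_ (by fun_prop))
        have := (hKm (a + 1) w₀ hw₀).const_mul (-a)
        simpa [neg_add', sub_eq_add_neg, add_comm] using this)
      (by
        filter_upwards [ae_restrict_mem measurableSet_Ioc] with u hu w hw
        rw [norm_mul]
        exact mul_le_mul_of_nonneg_left (hC (w, u) ⟨hw, Ioc_subset_Icc_self hu⟩) (norm_nonneg _))
      (hφ.norm.mul_const C)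
      (by
        filter_upwards [ae_restrict_mem measurableSet_Ioc] with u hu w hw
        have h1 : HasDerivAt (fun w : ℂ => 1 - (u : ℂ) * w) (-(u : ℂ)) w := by
          simpa using ((hasDerivAt_id w).const_mul (u : ℂ)).const_sub 1
        exact (h1.cpow_const (kernel_mem_slitPlane (hrU hw) (Ioc_subset_Icc_self hu))).const_mul _)
    exact this.2.differentiableAt
  · intro w hw
    set p : FormalMultilinearSeries ℂ ℂ ℂ := .ofScalars ℂ fun n : ℕ => Ring.choose (a + n - 1) n
    have hp := Complex.one_div_one_sub_cpow_hasFPowerSeriesOnBall_zero a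
    have happ : ∀ (n : ℕ) (v : ℂ), p n (fun _ => v) = Ring.choose (a + n - 1) n * v ^ n := by
      intro n v
      simp [p, mul_comm]
    have hmem : ∀ v : ℂ, ‖v‖ < 1 → v ∈ Metric.eball (0 : ℂ) 1 := by
      intro v hv
      rw [← ENNReal.ofReal_one, Metric.eball_ofReal]
      simpa using hv
    have hsum : Summable fun n : ℕ => ‖Ring.choose (a + n - 1) n‖ * ‖w‖ ^ n := by
      have := p.summable_norm_apply (x := w)
        (Metric.eball_subset_eball hp.r_le (hmem w hw))
      simpa [happ] using this
    have hF : ∀ n : ℕ, IntegrableOn (fun u : ℝ => gaussWeight b c u *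
        (Ring.choose (a + n - 1) n * ((u : ℂ) * w) ^ n)) (Ioc 0 1) := by
      intro n
      have hcn : ContinuousOn (fun u : ℝ => Ring.choose (a + n - 1) n * ((u : ℂ) * w) ^ n)
        (Icc 0 1) := by fun_prop
      obtain ⟨C, hC⟩ := isCompact_Icc.exists_bound_of_continuousOn hcn
      refine hφ.mul_bdd (c := C)
        ((hcn.mono Ioc_subset_Icc_self).aestronglyMeasurable measurableSet_Ioc) ?_
      filter_upwards [ae_restrict_mem measurableSet_Ioc] with u hu
      exact hC u (Ioc_subset_Icc_self hu)
    have hS : Summable fun n : ℕ => ∫ u in Ioc (0 : ℝ) 1, ‖gaussWeight b c u *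
        (Ring.choose (a + n - 1) n * ((u : ℂ) * w) ^ n)‖ := by
      refine Summable.of_nonneg_of_le (fun n => integral_nonneg fun _ => norm_nonneg _) (fun n => ?_)
        (hsum.mul_left (∫ u in Ioc (0 : ℝ) 1, ‖gaussWeight b c u‖))
      rw [← integral_mul_const]
      refine setIntegral_mono_on (hF n).norm (hφ.norm.mul_const _) measurableSet_Ioc fun u hu => ?_
      simp only [norm_mul, norm_pow, mul_pow, Complex.norm_real, Real.norm_eq_abs,
        abs_of_pos hu.1]
      have h1 : u ^ n ≤ 1 := pow_le_one₀ hu.1.le hu.2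
      gcongr
      exact mul_le_of_le_one_left (by positivity) h1
    have key := hasSum_integral_of_summable_integral_norm hF hS
    have hval : ∀ n : ℕ, ∫ u in Ioc (0 : ℝ) 1, gaussWeight b c u *
        (Ring.choose (a + n - 1) n * ((u : ℂ) * w) ^ n) =
        (Complex.Gamma b * Complex.Gamma (c - b)) *
          (Complex.regularizedGaussHGFunSeries a b c n fun _ => w) := by
      intro n
      have hb' : ∀ k : ℕ, b ≠ -k := fun k h => by
        have := congrArg Complex.re h
        simp at this
        have : (0 : ℝ) ≤ k := k.cast_nonneg
        linarith
      have hbn : 0 < (b + n).re := by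
        have : (0 : ℝ) ≤ n := n.cast_nonneg
        simp
        linarith
      have hint : ∫ u in Ioc (0 : ℝ) 1, gaussWeight b c u * (u : ℂ) ^ n =
          Complex.betaIntegral (b + n) (c - b) := by
        rw [Complex.betaIntegral, intervalIntegral.integral_of_le zero_le_one]
        refine setIntegral_congr_fun measurableSet_Ioc fun u hu => ?_
        have hu0 : (u : ℂ) ≠ 0 := by exact_mod_cast hu.1.ne'
        simp only [gaussWeight]
        rw [show b + n - 1 = (b - 1) + n by ring, Complex.cpow_add _ _ hu0, Complex.cpow_natCast]
        ring
      have hfac : Ring.choose (a + n - 1) n = (ascPochhammer ℂ n).eval a / n.factorial := by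
        rw [← Ring.multichoose_eq, eq_div_iff (by exact_mod_cast n.factorial_ne_zero),
          ← Polynomial.ascPochhammer_smeval_eq_eval,
          ← Ring.factorial_nsmul_multichoose_eq_ascPochhammer, nsmul_eq_mul, mul_comm]
      calc _ = ∫ u in Ioc (0 : ℝ) 1, (gaussWeight b c u * (u : ℂ) ^ n) *
            (Ring.choose (a + n - 1) n * w ^ n) := by
            congr 1; ext u; rw [mul_pow]; ring
        _ = _ := by
            rw [integral_mul_const, hint, Complex.betaIntegral_eq_Gamma_mul_div _ _ hbn hcb, hfac,
              FormalMultilinearSeries.apply_eq_prod_smul_coeff,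
              Complex.coeff_regularizedGaussHGFunSeries, ← Complex.Gamma_add_nat_div_Gamma_eq b hb',
              show b + n + (c - b) = c + n by ring]
            have := Complex.Gamma_ne_zero_of_re_pos hb
            simp
            field_simp
    have hsumK : ∀ u ∈ Ioc (0 : ℝ) 1, ∑' n : ℕ, gaussWeight b c u *
        (Ring.choose (a + n - 1) n * ((u : ℂ) * w) ^ n) =
        gaussWeight b c u * (1 - (u : ℂ) * w) ^ (-a) := by
      intro u hu
      have huw : ‖(u : ℂ) * w‖ < 1 := by
        rw [norm_mul, Complex.norm_real, Real.norm_eq_abs, abs_of_pos hu.1]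
        nlinarith [norm_nonneg w, hu.2, hu.1]
      have := (hp.hasSum (hmem _ huw)).mul_left (gaussWeight b c u)
      simp only [zero_add] at this
      rw [Complex.cpow_neg, ← one_div, ← this.tsum_eq]
      exact tsum_congr fun n => by rw [happ]
    have hne : Complex.Gamma b * Complex.Gamma (c - b) ≠ 0 :=
      mul_ne_zero (Complex.Gamma_ne_zero_of_re_pos hb) (Complex.Gamma_ne_zero_of_re_pos hcb)
    beta_reduce
    rw [setIntegral_congr_fun measurableSet_Ioc fun u hu => (hsumK u hu).symm, ← key.tsum_eq,
      tsum_congr hval, tsum_mul_left, inv_mul_cancel_left₀ hne]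
    rfl


theorem gaussWeight_mul_euler_kernel_eq_ofReal (a b c : ℝ) {w u : ℝ} (hw : w < 1)
    (hu : u ∈ Ioc (0 : ℝ) 1) :
    gaussWeight b c u * (1 - (u : ℂ) * w) ^ (-(a : ℂ)) =
      ((u ^ (b - 1) * (1 - u) ^ (c - b - 1) * (1 - w * u) ^ (-a) : ℝ) : ℂ) := by
  have h1 : 0 ≤ 1 - w * u := by nlinarith [hu.1, hu.2]
  push_cast
  rw [gaussWeight, Complex.ofReal_cpow hu.1.le, Complex.ofReal_cpow (sub_nonneg.2 hu.2),
    Complex.ofReal_cpow h1]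
  push_cast
  rw [mul_comm (w : ℂ)]

/-- Euler's integral for the regularized Gauss function at real arguments. -/
theorem regularizedGaussReal_eq_integral (a : ℝ) {b c : ℝ} (hb : 0 < b) (hbc : b < c) {w : ℝ}
    (hw : w < 1) :
    regularizedGaussReal a b c w = (Real.Gamma b * Real.Gamma (c - b))⁻¹ *
      ∫ u in Ioc (0 : ℝ) 1, u ^ (b - 1) * (1 - u) ^ (c - b - 1) * (1 - w * u) ^ (-a) := by
  have hmem : (w : ℂ) ∈ {w : ℂ | 1 - w ∈ Complex.slitPlane} := by
    rw [mem_ofPred_eq, Complex.mem_slitPlane_iff]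
    left
    simpa using hw
  have hbc' : (b : ℂ).re < (c : ℂ).re := by simpa using hbc
  -- `regularizedGauss` is an arbitrary choice among continuations; uniqueness on the slit plane
  -- identifies it with Euler's integral.
  rw [regularizedGaussReal, (regularizedGauss_spec a b c (by simpa using hb) hbc').eqOn
    (isGaussContinuation_eulerIntegral a b c (by simpa using hb) hbc') hmem]
  beta_reduce
  rw [setIntegral_congr_fun measurableSet_Ioc fun u hu =>
    gaussWeight_mul_euler_kernel_eq_ofReal a b c hw hu, integral_complex_ofReal,
    ← Complex.ofReal_sub, Complex.Gamma_ofReal, Complex.Gamma_ofReal]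
  norm_cast

theorem integrableOn_euler_integrand (a : ℝ) {b c : ℝ} (hb : 0 < b) (hbc : b < c) {w : ℝ}
    (hw : w < 1) :
    IntegrableOn (fun u : ℝ => u ^ (b - 1) * (1 - u) ^ (c - b - 1) * (1 - w * u) ^ (-a))
      (Ioc 0 1) := by
  have h := integrableOn_gaussWeight_mul_euler_kernel (a : ℂ) (b := b) (c := c) (w := w)
    (by simpa using hb) (by simpa using hbc) (by
      rw [Complex.mem_slitPlane_iff]
      left
      simpa using hw)
  have h2 := h.congr_fun (fun u hu => gaussWeight_mul_euler_kernel_eq_ofReal a b c hw hu)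
    measurableSet_Ioc
  simpa [IntegrableOn] using h2.re

theorem regularizedGaussReal_nonneg (a : ℝ) {b c : ℝ} (hb : 0 < b) (hbc : b < c) {w : ℝ}
    (hw : w < 1) : 0 ≤ regularizedGaussReal a b c w := by
  rw [regularizedGaussReal_eq_integral a hb hbc hw]
  have h1 := Real.Gamma_pos_of_pos hb
  have h2 := Real.Gamma_pos_of_pos (sub_pos.2 hbc)
  refine mul_nonneg (by positivity) (setIntegral_nonneg measurableSet_Ioc fun u hu => ?_)
  have h3 : 0 ≤ 1 - w * u := by nlinarith [hu.1, hu.2]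
  have := hu.1
  have := sub_nonneg.2 hu.2
  positivity

theorem contDiffAt_regularizedGaussReal (a : ℝ) {b c : ℝ} (hb : 0 < b) (hbc : b < c) {w : ℝ}
    (hw : w < 1) : ContDiffAt ℝ (⊤ : ℕ∞) (regularizedGaussReal a b c) w := by
  have hmem : (w : ℂ) ∈ {w : ℂ | 1 - w ∈ Complex.slitPlane} := by
    rw [mem_ofPred_eq, Complex.mem_slitPlane_iff]
    left
    simpa using hw
  have h := (regularizedGauss_spec a b c (by simpa using hb) (by simpa using hbc)).1 _ hmem
  exact (h.contDiffAt (n := (⊤ : ℕ∞))).real_of_complex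

/-! ### Moments of a weighted sum of two Gamma variables -/

theorem lintegral_gammaMeasure (a r : ℝ) {f : ℝ → ℝ≥0∞} (hf : Measurable f) :
    ∫⁻ u, f u ∂(gammaMeasure a r) = ∫⁻ u in Ioi (0 : ℝ),
      ENNReal.ofReal (r ^ a / Real.Gamma a * u ^ (a - 1) * Real.exp (-(r * u))) * f u := by
  have hm : Measurable (gammaPDF a r) := (measurable_gammaPDFReal a r).ennreal_ofReal
  rw [gammaMeasure, lintegral_withDensity_eq_lintegral_mul _ hm hf,
    ← setLIntegral_eq_of_support_subset (s := Ici 0) ?_, setLIntegral_congr Ioi_ae_eq_Ici.symm]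
  · refine setLIntegral_congr_fun measurableSet_Ioi fun u hu => ?_
    rw [Pi.mul_apply, gammaPDF_of_nonneg (le_of_lt hu)]
  · intro u hu
    by_contra h
    refine hu ?_
    rw [Pi.mul_apply, gammaPDF_of_neg (not_le.1 h), zero_mul]

/-- Change of variables to the total `s = x + y` and the proportion `u = y / s`; the factor `s` is
the Jacobian. -/
theorem setLIntegral_Ioi_Ioi_eq {F : ℝ → ℝ → ℝ≥0∞} (hF : Measurable (Function.uncurry F)) :
    ∫⁻ x in Ioi (0 : ℝ), ∫⁻ y in Ioi (0 : ℝ), F x y =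
      ∫⁻ s in Ioi (0 : ℝ), ENNReal.ofReal s *
        ∫⁻ u in Ioo (0 : ℝ) 1, F (s * (1 - u)) (s * u) := by
  have h1 : ∀ x : ℝ, ∫⁻ y in Ioi (0 : ℝ), F x y =
      ∫⁻ s, (Ioi (0 : ℝ)).indicator (fun y => F x y) (s - x) := fun x => by
    rw [lintegral_sub_right_eq_self, lintegral_indicator measurableSet_Ioi]
  simp_rw [h1]
  rw [← lintegral_indicator measurableSet_Ioi]
  have h2 : ∀ x : ℝ, (Ioi (0 : ℝ)).indicator
      (fun x => ∫⁻ s, (Ioi (0 : ℝ)).indicator (fun y => F x y) (s - x)) x =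
      ∫⁻ s, (Ioo 0 s).indicator (fun x => F x (s - x)) x := fun x => by
    by_cases hx : 0 < x
    · rw [indicator_of_mem (mem_Ioi.2 hx)]
      refine lintegral_congr fun s => ?_
      by_cases hs : x < s <;> simp [indicator, hx, hs]
    · rw [indicator_of_notMem (by simpa using hx)]
      have : ∀ s, (Ioo 0 s).indicator (fun x => F x (s - x)) x = 0 := fun s =>
        indicator_of_notMem (fun h => hx h.1) _
      simp [this]
  simp_rw [h2]
  rw [lintegral_lintegral_swap]
  · rw [← lintegral_indicator measurableSet_Ioi]
    refine lintegral_congr fun s => ?_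
    rw [lintegral_indicator measurableSet_Ioo]
    by_cases hs : 0 < s
    · rw [indicator_of_mem (mem_Ioi.2 hs)]
      -- With the total `s` fixed, `x` runs over `(0, s)` and is rescaled to the unit interval.
      have him : (fun u : ℝ => s * (1 - u)) '' Ioo 0 1 = Ioo 0 s := by
        ext y
        constructor
        · rintro ⟨u, hu, rfl⟩
          exact ⟨mul_pos hs (by linarith [hu.2]), by nlinarith [hu.1]⟩
        · rintro ⟨hy0, hys⟩
          refine ⟨1 - y / s, ⟨by rw [sub_pos, div_lt_one hs]; exact hys, ?_⟩, ?_⟩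
          · linarith [div_pos hy0 hs]
          · field_simp
            ring
      rw [← him, lintegral_image_eq_lintegral_abs_deriv_mul (f' := fun _ => -s)
        measurableSet_Ioo]
      · rw [← lintegral_const_mul']
        · refine lintegral_congr fun u => ?_
          rw [abs_neg, abs_of_pos hs]
          congr 2
          ring
        · exact ENNReal.ofReal_ne_top
      · intro u _
        have := ((hasDerivAt_id u).const_sub 1).const_mul s
        simpa using this.hasDerivWithinAt
      · intro u _ v _ huv
        have := mul_left_cancel₀ hs.ne' huv
        linarith
    · rw [indicator_of_notMem (by simpa using hs), Ioo_eq_empty hs]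
      simp
  · refine Measurable.aemeasurable ?_
    have : (Function.uncurry fun x s : ℝ => (Ioo 0 s).indicator (fun x => F x (s - x)) x) =
        {p : ℝ × ℝ | 0 < p.1 ∧ p.1 < p.2}.indicator
          fun p => Function.uncurry F (p.1, p.2 - p.1) := by
      ext p
      simp [Function.uncurry, indicator]
    rw [this]
    refine Measurable.indicator (hF.comp (by fun_prop)) ?_
    exact (measurableSet_lt measurable_const measurable_fst).inter
      (measurableSet_lt measurable_fst measurable_snd)

theorem lintegral_gammaMeasure_rpow {m δ : ℝ} (hm : 0 < m) (hδ : 0 < δ) :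
    ∫⁻ u, ENNReal.ofReal u ^ δ ∂(gammaMeasure m m) =
      ENNReal.ofReal ((1 / m) ^ δ * (Real.Gamma (δ + m) / Real.Gamma m)) := by
  have hG := Real.Gamma_pos_of_pos hm
  rw [lintegral_gammaMeasure _ _ (by fun_prop)]
  have : ∀ u ∈ Ioi (0 : ℝ), ENNReal.ofReal (m ^ m / Real.Gamma m * u ^ (m - 1) *
      Real.exp (-(m * u))) * ENNReal.ofReal u ^ δ = ENNReal.ofReal (m ^ m / Real.Gamma m) *
      ENNReal.ofReal (u ^ ((δ + m) - 1) * Real.exp (-(m * u))) := fun u hu => by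
    have hu0 : 0 < u := hu
    rw [ENNReal.ofReal_rpow_of_pos hu0, ← ENNReal.ofReal_mul (by positivity),
      ← ENNReal.ofReal_mul (by positivity), show δ + m - 1 = (m - 1) + δ by ring,
      Real.rpow_add hu0]
    congr 1
    ring
  rw [setLIntegral_congr_fun measurableSet_Ioi this, lintegral_const_mul _ (by fun_prop),
    lintegral_Ioi_rpow_mul_exp_neg (by linarith) hm, ← ENNReal.ofReal_mul (by positivity)]
  congr 1
  rw [Real.rpow_add (by positivity), one_div, Real.inv_rpow hm.le, Real.inv_rpow hm.le]
  have : m ^ m ≠ 0 := by positivity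
  field_simp

/-- In total-and-proportion coordinates the integrand separates. The total gives `Γ(δ + 2 m)`, and
the proportion gives Euler's integral with parameters `-δ, m, 2 m` at `1 - b / a`. -/
theorem lintegral_gammaMeasure_add_rpow {m δ a b : ℝ} (hm : 0 < m) (hδ : 0 < δ) (ha : 0 < a)
    (hb : 0 < b) :
    ∫⁻ u, ∫⁻ v, (ENNReal.ofReal a * ENNReal.ofReal u + ENNReal.ofReal b * ENNReal.ofReal v) ^ δ
      ∂(gammaMeasure m m) ∂(gammaMeasure m m) =
      ENNReal.ofReal (a ^ δ * (1 / m) ^ δ * Real.Gamma (δ + 2 * m) *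
        regularizedGaussReal (-δ) m (2 * m) (1 - b / a)) := by
  have hG := Real.Gamma_pos_of_pos hm
  have hw : 1 - b / a < 1 := by linarith [div_pos hb ha]
  set C := m ^ m / Real.Gamma m with hC
  have hC0 : 0 < C := by positivity
  have h1 : ∀ u, ∫⁻ v, (ENNReal.ofReal a * ENNReal.ofReal u +
      ENNReal.ofReal b * ENNReal.ofReal v) ^ δ ∂(gammaMeasure m m) =
      ∫⁻ v in Ioi (0 : ℝ), ENNReal.ofReal (C * v ^ (m - 1) * Real.exp (-(m * v))) *
        (ENNReal.ofReal a * ENNReal.ofReal u + ENNReal.ofReal b * ENNReal.ofReal v) ^ δ :=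
    fun u => lintegral_gammaMeasure _ _ (by fun_prop)
  simp_rw [h1]
  rw [lintegral_gammaMeasure _ _ (by fun_prop)]
  simp_rw [← lintegral_const_mul' _ _ ENNReal.ofReal_ne_top]
  rw [setLIntegral_Ioi_Ioi_eq (by fun_prop)]
  set E : ℝ → ℝ := fun u => u ^ (m - 1) * (1 - u) ^ (2 * m - m - 1) *
    (1 - (1 - b / a) * u) ^ (-(-δ)) with hE
  have hEi : IntegrableOn E (Ioo 0 1) :=
    (integrableOn_euler_integrand (-δ) hm (by linarith) hw).mono_set Ioo_subset_Ioc_self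
  have hreg : regularizedGaussReal (-δ) m (2 * m) (1 - b / a) =
      (Real.Gamma m * Real.Gamma m)⁻¹ * ∫ u in Ioo (0 : ℝ) 1, E u := by
    rw [regularizedGaussReal_eq_integral (-δ) hm (by linarith) hw, integral_Ioc_eq_integral_Ioo,
      show 2 * m - m = m by ring]
    simp only [hE, show 2 * m - m - 1 = m - 1 by ring]
  have hE0 : ∀ u ∈ Ioo (0 : ℝ) 1, 0 ≤ E u := fun u hu => by
    have h1 : 0 ≤ 1 - (1 - b / a) * u := by nlinarith [hu.1, hu.2]
    have := hu.1
    have := sub_pos.2 hu.2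
    positivity
  have hin : ∀ s ∈ Ioi (0 : ℝ), ENNReal.ofReal s * ∫⁻ u in Ioo (0 : ℝ) 1,
      ENNReal.ofReal (C * (s * (1 - u)) ^ (m - 1) * Real.exp (-(m * (s * (1 - u))))) *
      (ENNReal.ofReal (C * (s * u) ^ (m - 1) * Real.exp (-(m * (s * u)))) *
      (ENNReal.ofReal a * ENNReal.ofReal (s * (1 - u)) +
        ENNReal.ofReal b * ENNReal.ofReal (s * u)) ^ δ) =
      ENNReal.ofReal (s ^ ((δ + 2 * m) - 1) * Real.exp (-(m * s))) *
        ENNReal.ofReal (C ^ 2 * a ^ δ * ∫ u in Ioo (0 : ℝ) 1, E u) := by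
    intro s hs
    have hs0 : 0 < s := hs
    rw [ENNReal.ofReal_mul (q := ∫ u in Ioo (0 : ℝ) 1, E u) (by positivity),
      ofReal_integral_eq_lintegral_ofReal hEi
        (by filter_upwards [ae_restrict_mem measurableSet_Ioo] with u hu using hE0 u hu),
      ← lintegral_const_mul' _ _ ENNReal.ofReal_ne_top,
      ← lintegral_const_mul' _ _ ENNReal.ofReal_ne_top,
      ← lintegral_const_mul' _ _ ENNReal.ofReal_ne_top]
    refine setLIntegral_congr_fun measurableSet_Ioo fun u hu => ?_
    have hu0 := hu.1
    have hu1 := sub_pos.2 hu.2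
    have hk : 0 < 1 - (1 - b / a) * u := by
      have : 1 - (1 - b / a) * u = (1 - u) + b / a * u := by ring
      rw [this]
      positivity
    -- This factorization produces the Euler kernel and fixes its argument `1 - b / a`.
    have hab : a * (s * (1 - u)) + b * (s * u) = a * s * (1 - (1 - b / a) * u) := by
      field_simp
      ring
    rw [← ENNReal.ofReal_mul ha.le, ← ENNReal.ofReal_mul hb.le,
      ← ENNReal.ofReal_add (by positivity) (by positivity), hab,
      ENNReal.ofReal_rpow_of_pos (by positivity), ← ENNReal.ofReal_mul (by positivity),
      ← ENNReal.ofReal_mul (by positivity), ← ENNReal.ofReal_mul (by positivity),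
      ← ENNReal.ofReal_mul (by positivity), ← ENNReal.ofReal_mul (by positivity)]
    congr 1
    rw [hE]
    beta_reduce
    rw [neg_neg, show 2 * m - m - 1 = m - 1 by ring, Real.mul_rpow (by positivity) hk.le,
      Real.mul_rpow ha.le hs0.le, Real.mul_rpow hs0.le hu1.le, Real.mul_rpow hs0.le hu0.le,
      show -(m * s) = -(m * (s * (1 - u))) + -(m * (s * u)) by ring, Real.exp_add,
      show δ + 2 * m - 1 = 1 + (m - 1) + (m - 1) + δ by ring, Real.rpow_add hs0,
      Real.rpow_add hs0, Real.rpow_add hs0, Real.rpow_one]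
    ring
  rw [setLIntegral_congr_fun measurableSet_Ioi hin, lintegral_mul_const' _ _ ENNReal.ofReal_ne_top,
    lintegral_Ioi_rpow_mul_exp_neg (by linarith) hm, ← ENNReal.ofReal_mul (by
      have := Real.Gamma_pos_of_pos (show 0 < δ + 2 * m by linarith)
      positivity), hreg]
  congr 1
  generalize (∫ u in Ioo (0 : ℝ) 1, E u) = J
  rw [hC, Real.rpow_add (by positivity), one_div, Real.inv_rpow hm.le,
    Real.inv_rpow hm.le, show 2 * m = m + m by ring, Real.rpow_add hm]
  have : m ^ m ≠ 0 := by positivity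
  field_simp

/-! ### Joint Laplace transform of the two interference powers. -/

theorem measurable_interference {Ω : Type*} [MeasurableSpace Ω] (d α : ℝ) {x : ℕ → Ω → Plane}
    {h : ℕ → Ω → ℝ} (hx : ∀ i, Measurable (x i)) (hh : ∀ i, Measurable (h i)) :
    Measurable (interference d α x h) := by
  unfold interference
  fun_prop

namespace IsNakagamiPoissonModel

variable {Ω : Type*} [MeasurableSpace Ω] {P : Measure Ω} [IsProbabilityMeasure P]
  {lam d α mD mI : ℝ} {x : ℕ → Ω → Plane} {g : Fin 2 → Ω → ℝ} {h : Fin 2 → ℕ → Ω → ℝ}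

/-- The marked Laplace functional leaves a planar integral of mark averages. Exchanging the two
integrations, the planar one at fixed marks is explicit and leaves only a fractional moment of the
marks. -/
theorem lintegral_expNeg_interference (hmodel : IsNakagamiPoissonModel P 2 lam mD mI x g h)
    (hlam : 0 ≤ lam) (hd : 0 < d) (hα : 2 < α) (hmI : 0 < mI) {a b : ℝ≥0∞} (ha : a ≠ ∞)
    (hb : b ≠ ∞) :
    ∫⁻ ω, expNeg (a * interference d α x (h 0) ω + b * interference d α x (h 1) ω) ∂P =
      expNeg (ENNReal.ofReal (lam * (Real.pi * Real.Gamma (1 - 2 / α)) * d ^ 2) *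
        ∫⁻ u, ∫⁻ v, (a * ENNReal.ofReal u + b * ENNReal.ofReal v) ^ (2 / α)
          ∂(gammaMeasure mI mI) ∂(gammaMeasure mI mI)) := by
  have hpγ := isProbabilityMeasure_gammaMeasure hmI hmI
  let H : Fin 2 × ℕ → Ω → ℝ := fun q => h q.1 q.2
  let l : Plane → ℝ≥0∞ := fun y => ENNReal.ofReal d ^ α * ‖y‖ₑ ^ (-α)
  have hl : Measurable l := by fun_prop
  let c : Fin 2 → ℝ≥0∞ := ![a, b]
  have hind : iIndepFun H P := hmodel.indep_fading.precomp Sum.inr_injective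
  have hindx : IndepFun (fun ω i => x i ω) (fun ω q => H q ω) P :=
    hmodel.indep_locations.comp (φ := id)
      (ψ := fun p : (Fin 2 → ℝ) × (Fin 2 → ℕ → ℝ) => fun q : Fin 2 × ℕ => p.2 q.1 q.2)
      measurable_id (by fun_prop)
  have key := hmodel.poisson.lintegral_expNeg_marks hlam
    (fun q => hmodel.measurable_interf q.1 q.2) (fun q => hmodel.law_interf q.1 q.2) hind hindx c hl
  have hL : ∀ ω, ∑' i, (∑ n, c n * ENNReal.ofReal (h n i ω)) * l (x i ω) =
      a * interference d α x (h 0) ω + b * interference d α x (h 1) ω := fun ω => by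
    simp only [interference, Fin.sum_univ_two, c, l, ← ENNReal.tsum_mul_left, Matrix.cons_val_zero,
      Matrix.cons_val_one]
    rw [← ENNReal.tsum_add]
    exact tsum_congr fun i => by ring
  simp_rw [hL] at key
  rw [key]
  have hm2 : Measurable fun q : Plane × (ℝ × ℝ) =>
      expNeg ((a * ENNReal.ofReal q.2.1 + b * ENNReal.ofReal q.2.2) * l q.1) := by fun_prop
  -- The two mark transforms at one point combine into one expectation over the product law, so `1 -
  -- ·` moves inside it.
  have hR : ∀ y, 1 - ∏ n, ∫⁻ u, expNeg (c n * ENNReal.ofReal u * l y) ∂(gammaMeasure mI mI) =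
      ∫⁻ p : ℝ × ℝ, (1 - expNeg ((a * ENNReal.ofReal p.1 + b * ENNReal.ofReal p.2) * l y))
        ∂((gammaMeasure mI mI).prod (gammaMeasure mI mI)) := fun y => by
    have hmy : Measurable fun p : ℝ × ℝ =>
        expNeg ((a * ENNReal.ofReal p.1 + b * ENNReal.ofReal p.2) * l y) := by fun_prop
    rw [lintegral_sub hmy, lintegral_one, measure_univ, Fin.prod_univ_two,
      ← lintegral_prod_mul]
    · congr 1
      refine lintegral_congr fun p => ?_
      rw [add_mul, expNeg_add]
      rfl
    · fun_prop
    · fun_prop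
    · refine ((lintegral_mono fun p => expNeg_le_one _).trans_lt ?_).ne
      simp
    · exact ae_of_all _ fun p => expNeg_le_one _
  simp_rw [hR]
  rw [lintegral_lintegral_swap (measurable_const.sub hm2).aemeasurable]
  have hI : ∀ p : ℝ × ℝ, ∫⁻ y : Plane,
      (1 - expNeg ((a * ENNReal.ofReal p.1 + b * ENNReal.ofReal p.2) * l y)) =
      ENNReal.ofReal (Real.pi * Real.Gamma (1 - 2 / α) * d ^ 2) *
        (a * ENNReal.ofReal p.1 + b * ENNReal.ofReal p.2) ^ (2 / α) := fun p => by
    simp_rw [l, ← mul_assoc]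
    have hne : a * ENNReal.ofReal p.1 + b * ENNReal.ofReal p.2 ≠ ∞ :=
      ENNReal.add_ne_top.2 ⟨ENNReal.mul_ne_top ha ENNReal.ofReal_ne_top,
        ENNReal.mul_ne_top hb ENNReal.ofReal_ne_top⟩
    have hdα : ENNReal.ofReal d ^ α ≠ ∞ :=
      ENNReal.rpow_ne_top_of_nonneg (by linarith) ENNReal.ofReal_ne_top
    rw [lintegral_one_sub_expNeg_pathLoss hα (ENNReal.mul_ne_top hne hdα),
      ENNReal.mul_rpow_of_nonneg _ _ (by positivity), ← ENNReal.rpow_mul,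
      show α * (2 / α) = ((2 : ℕ) : ℝ) by field_simp; norm_num, ENNReal.rpow_natCast,
      ← ENNReal.ofReal_pow hd.le, ENNReal.ofReal_mul' (q := d ^ 2) (by positivity)]
    ring
  simp_rw [hI]
  rw [lintegral_const_mul _ (by fun_prop), ← mul_assoc, ← ENNReal.ofReal_mul hlam,
    lintegral_prod _ (by fun_prop)]
  simp only [mul_assoc]

/-- For `ε > 0` the variable `exp (-ε S)` vanishes where `S = ∞`, hence `E[exp (-ε S)] ≤ P(S < ∞)`.
The left side is `exp (-C K ε ^ (2/α))`, which tends to `1` as `ε → 0`. -/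
theorem interference_ae_ne_top (hmodel : IsNakagamiPoissonModel P 2 lam mD mI x g h)
    (hlam : 0 ≤ lam) (hd : 0 < d) (hα : 2 < α) (hmI : 0 < mI) :
    ∀ᵐ ω ∂P, ∀ n, interference d α x (h n) ω ≠ ∞ := by
  set S : Ω → ℝ≥0∞ := fun ω => interference d α x (h 0) ω + interference d α x (h 1) ω with hS
  have hSm : Measurable S :=
    (measurable_interference d α hmodel.poisson.measurable fun i =>
      hmodel.measurable_interf 0 i).add (measurable_interference d α hmodel.poisson.measurable
        fun i => hmodel.measurable_interf 1 i)
  have hδ : 0 < 2 / α := by positivity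
  set C := ENNReal.ofReal (lam * (Real.pi * Real.Gamma (1 - 2 / α)) * d ^ 2) with hC
  set K := ∫⁻ u, ∫⁻ v, (ENNReal.ofReal u + ENNReal.ofReal v) ^ (2 / α)
    ∂(gammaMeasure mI mI) ∂(gammaMeasure mI mI) with hK
  have hKtop : K ≠ ∞ := by
    have := lintegral_gammaMeasure_add_rpow hmI hδ one_pos one_pos
    simp only [ENNReal.ofReal_one, one_mul] at this
    rw [hK, this]
    exact ENNReal.ofReal_ne_top
  have hle : ∀ k : ℕ, expNeg (C * K * ((k + 1 : ℕ) : ℝ≥0∞)⁻¹ ^ (2 / α)) ≤ P {ω | S ω ≠ ∞} := by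
    intro k
    set ε : ℝ≥0∞ := ((k + 1 : ℕ) : ℝ≥0∞)⁻¹ with hε
    have hεtop : ε ≠ ∞ := by simp [hε]
    have hε0 : ε ≠ 0 := ENNReal.inv_ne_zero.2 (ENNReal.natCast_ne_top _)
    have h1 := hmodel.lintegral_expNeg_interference hlam hd hα hmI hεtop hεtop
    simp_rw [← mul_add, ENNReal.mul_rpow_of_nonneg _ _ hδ.le] at h1
    simp_rw [lintegral_const_mul' _ _ (ENNReal.rpow_ne_top_of_nonneg hδ.le hεtop)] at h1
    calc expNeg (C * K * ε ^ (2 / α)) = ∫⁻ ω, expNeg (ε * S ω) ∂P := by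
          rw [h1]
          congr 1
          ring
      _ ≤ ∫⁻ ω, {ω | S ω ≠ ∞}.indicator 1 ω ∂P := by
          refine lintegral_mono fun ω => ?_
          by_cases hω : S ω = ∞
          · simp [hω, ENNReal.mul_top hε0, expNeg_top]
          · rw [indicator_of_mem (by exact hω)]
            exact expNeg_le_one _
      _ = _ := lintegral_indicator_one (measurableSet_eq_fun hSm measurable_const).compl
  have hlim : Tendsto (fun k : ℕ => expNeg (C * K * ((k + 1 : ℕ) : ℝ≥0∞)⁻¹ ^ (2 / α))) atTop
      (𝓝 1) := by
    have h1 : Tendsto (fun k : ℕ => ((k + 1 : ℕ) : ℝ≥0∞)⁻¹ ^ (2 / α)) atTop (𝓝 0) := by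
      have := ((ENNReal.continuous_rpow_const (y := 2 / α)).tendsto 0).comp
        (ENNReal.tendsto_inv_nat_nhds_zero.comp (tendsto_add_atTop_nat 1))
      rwa [ENNReal.zero_rpow_of_pos hδ] at this
    have h2 := ENNReal.Tendsto.const_mul h1
      (Or.inr (ENNReal.mul_ne_top (ENNReal.ofReal_ne_top) hKtop) : _ ∨ C * K ≠ ∞)
    rw [mul_zero] at h2
    have h3 := (continuous_expNeg.tendsto 0).comp h2
    rwa [expNeg_zero] at h3
  have h1 : P {ω | S ω ≠ ∞} = 1 :=
    le_antisymm prob_le_one (le_of_tendsto' hlim hle)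
  have h2 : ∀ᵐ ω ∂P, S ω ≠ ∞ :=
    (prob_compl_eq_zero_iff (measurableSet_eq_fun hSm measurable_const).compl).2 h1
  filter_upwards [h2] with ω hω n
  rw [hS, ENNReal.add_ne_top] at hω
  fin_cases n
  exacts [hω.1, hω.2]

end IsNakagamiPoissonModel

theorem calA_nonneg {d α T mD mI z s t : ℝ} (hα : 2 < α) (hmD : 0 < mD) (hmI : 0 < mI)
    (hz : 0 < z) (hs : 0 < s) (ht : 0 < t) : 0 ≤ calA d α T mD mI z s t := by
  have hδ : 0 < 2 / α := by positivity
  have hδ1 : 0 < 1 - 2 / α := by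
    rw [sub_pos, div_lt_one (by linarith)]
    exact hα
  have hΓ := Real.Gamma_pos_of_pos hδ1
  unfold calA
  split_ifs with hzT
  · have hTz := sub_pos.2 hzT
    have h1 := regularizedGaussReal_nonneg (-(2 / α)) (b := mI) (c := 2 * mI) hmI (by linarith)
      (w := 1 - z * t / ((T - z) * s)) (by
        have : 0 < z * t / ((T - z) * s) := by positivity
        linarith)
    have h2 := Real.Gamma_pos_of_pos (show 0 < 2 / α + 2 * mI by positivity)
    positivity
  · have h1 := Real.Gamma_pos_of_pos (show 0 < 2 / α + mI by positivity)
    have h2 := Real.Gamma_pos_of_pos hmI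
    positivity

/-- For `z < T` this is the two-variable Gamma moment, with `mD` cancelling in the ratio of weights.
For `z ≥ T` the first weight vanishes and a single Gamma moment remains. -/
theorem ofReal_mul_lintegral_eq_calA {lam d α T mD mI z s t : ℝ} (hlam : 0 ≤ lam) (hα : 2 < α)
    (hmD : 0 < mD) (hmI : 0 < mI) (hz : 0 < z) (hs : 0 < s) (ht : 0 < t) :
    ENNReal.ofReal (lam * (Real.pi * Real.Gamma (1 - 2 / α)) * d ^ 2) *
      ∫⁻ u, ∫⁻ v, (ENNReal.ofReal (max 0 (T - z) * s * mD) * ENNReal.ofReal u +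
        ENNReal.ofReal (z * t * mD) * ENNReal.ofReal v) ^ (2 / α)
          ∂(gammaMeasure mI mI) ∂(gammaMeasure mI mI) =
      ENNReal.ofReal (Real.pi * lam * calA d α T mD mI z s t) := by
  have hδ : 0 < 2 / α := by positivity
  have hδ1 : 0 < 1 - 2 / α := by
    rw [sub_pos, div_lt_one (by linarith)]
    exact hα
  have hΓ := Real.Gamma_pos_of_pos hδ1
  unfold calA
  split_ifs with hzT
  · have hTz := sub_pos.2 hzT
    rw [max_eq_right hTz.le, lintegral_gammaMeasure_add_rpow hmI hδ (by positivity)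
      (by positivity), ← ENNReal.ofReal_mul (by positivity),
      mul_div_mul_right _ _ hmD.ne', Real.mul_rpow (by positivity) hmD.le,
      Real.mul_rpow hTz.le hs.le, one_div, Real.inv_rpow hmI.le, Real.div_rpow hmD.le hmI.le]
    congr 1
    ring
  · rw [max_eq_left (by linarith)]
    have hpγ := isProbabilityMeasure_gammaMeasure hmI hmI
    simp_rw [zero_mul, ENNReal.ofReal_zero, zero_mul, zero_add,
      ENNReal.mul_rpow_of_nonneg _ _ hδ.le]
    rw [lintegral_const, measure_univ, mul_one, lintegral_const_mul _ (by fun_prop),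
      lintegral_gammaMeasure_rpow hmI hδ, ENNReal.ofReal_rpow_of_pos (by positivity),
      ← ENNReal.ofReal_mul (by positivity), ← ENNReal.ofReal_mul (by positivity),
      Real.mul_rpow (by positivity) hmD.le, one_div, Real.inv_rpow hmI.le,
      Real.div_rpow hmD.le hmI.le]
    congr 1
    ring

/-! ### Derivatives of Laplace transforms -/

section Derivatives

variable {Ω : Type*} [MeasurableSpace Ω] {P : Measure Ω} [IsProbabilityMeasure P]

theorem pow_mul_exp_neg_le (n : ℕ) {y : ℝ} (hy : 0 ≤ y) :
    y ^ n * Real.exp (-y) ≤ n.factorial := by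
  have := Real.pow_div_factorial_le_exp y hy n
  rw [div_le_iff₀ (by positivity)] at this
  rw [Real.exp_neg, ← div_eq_mul_inv, div_le_iff₀ (Real.exp_pos y), mul_comm]
  exact this

/-- Weighting `P` by the bounded `W` gives a finite measure under which the integral is the moment
generating function of `-Z`. It is finite on `(0, ∞)`, so it may be differentiated under the
integral there. -/
theorem iteratedDeriv_integral_mul_exp_neg {W Z : Ω → ℝ} (hW : Measurable W) (hZ : Measurable Z)
    (hW0 : ∀ ω, 0 ≤ W ω) (hZ0 : ∀ ω, 0 ≤ Z ω) {C : ℝ} (hWC : ∀ ω, W ω ≤ C) (n : ℕ) {t : ℝ}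
    (ht : 0 < t) :
    iteratedDeriv n (fun t => ∫ ω, W ω * Real.exp (-(t * Z ω)) ∂P) t =
      (-1) ^ n * ∫ ω, W ω * (Z ω ^ n * Real.exp (-(t * Z ω))) ∂P := by
  set μ := P.withDensity fun ω => ENNReal.ofReal (W ω) with hμ
  have hμint : ∀ f : Ω → ℝ, ∫ ω, f ω ∂μ = ∫ ω, W ω * f ω ∂P := fun f => by
    rw [hμ, integral_withDensity_eq_integral_toReal_smul hW.ennreal_ofReal
      (ae_of_all _ fun ω => ENNReal.ofReal_lt_top)]
    simp [ENNReal.toReal_ofReal (hW0 _)]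
  have : IsFiniteMeasure μ := by
    refine isFiniteMeasure_withDensity ((lintegral_mono fun ω =>
      ENNReal.ofReal_le_ofReal (hWC ω)).trans_lt ?_).ne
    simp
  have hsub : Ioi 0 ⊆ integrableExpSet (fun ω => -Z ω) μ := fun s hs => by
    refine Integrable.of_bound (C := 1) (by fun_prop) (ae_of_all _ fun ω => ?_)
    rw [Real.norm_eq_abs, Real.abs_exp, Real.exp_le_one_iff]
    have : (0 : ℝ) < s := hs
    nlinarith [hZ0 ω]
  have hint : t ∈ interior (integrableExpSet (fun ω => -Z ω) μ) :=
    interior_maximal hsub isOpen_Ioi ht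
  have h1 : (fun t => ∫ ω, W ω * Real.exp (-(t * Z ω)) ∂P) = mgf (fun ω => -Z ω) μ := by
    ext s
    rw [mgf, hμint]
    simp
  rw [h1, iteratedDeriv_mgf hint, hμint, ← integral_const_mul]
  refine integral_congr_ae (ae_of_all _ fun ω => ?_)
  beta_reduce
  rw [neg_pow, mul_neg]
  ring

/-- Each differentiation treats the other factor as a bounded weight: `exp (-s X) ≤ 1` for the
derivatives in `t`, then `Y ^ m exp (-Y) ≤ m!` for those in `s`. -/
theorem mixedDeriv_eq_integral {X Y : Ω → ℝ} (hX : Measurable X) (hY : Measurable Y)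
    (hX0 : ∀ ω, 0 ≤ X ω) (hY0 : ∀ ω, 0 ≤ Y ω) {f : ℝ → ℝ → ℝ}
    (hf : ∀ s t, 0 < s → 0 < t → f s t = ∫ ω, Real.exp (-(s * X ω)) * Real.exp (-(t * Y ω)) ∂P)
    (k m : ℕ) :
    mixedDeriv k m f = (-1) ^ (k + m) *
      ∫ ω, X ω ^ k * Y ω ^ m * Real.exp (-X ω - Y ω) ∂P := by
  have hinner : ∀ s, 0 < s → iteratedDeriv m (fun t => f s t) 1 =
      (-1) ^ m * ∫ ω, (Y ω ^ m * Real.exp (-Y ω)) * Real.exp (-(s * X ω)) ∂P := by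
    intro s hs
    -- Derivatives at `1` depend only on the germ, so the formula for positive arguments suffices.
    have hev : (fun t => f s t) =ᶠ[𝓝 1]
        fun t => ∫ ω, Real.exp (-(s * X ω)) * Real.exp (-(t * Y ω)) ∂P := by
      filter_upwards [lt_mem_nhds one_pos] with t ht using hf s t hs ht
    rw [hev.iteratedDeriv_eq m, iteratedDeriv_integral_mul_exp_neg (by fun_prop) hY
      (fun ω => (Real.exp_pos _).le) hY0 (C := 1) (fun ω => ?_) m one_pos]
    · simp_rw [one_mul, mul_comm]
    · rw [Real.exp_le_one_iff]
      nlinarith [hX0 ω]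
  have hev : (fun s => iteratedDeriv m (fun t => f s t) 1) =ᶠ[𝓝 1]
      fun s => (-1) ^ m * ∫ ω, (Y ω ^ m * Real.exp (-Y ω)) * Real.exp (-(s * X ω)) ∂P := by
    filter_upwards [lt_mem_nhds one_pos] with s hs using hinner s hs
  rw [mixedDeriv, hev.iteratedDeriv_eq k, iteratedDeriv_const_mul_field,
    iteratedDeriv_integral_mul_exp_neg (by fun_prop) hX
      (fun ω => by have := hY0 ω; positivity) hX0 (fun ω => pow_mul_exp_neg_le m (hY0 ω)) k one_pos,
    ← mul_assoc, pow_add, mul_comm ((-1 : ℝ) ^ k)]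
  congr 1
  refine integral_congr_ae (ae_of_all _ fun ω => ?_)
  beta_reduce
  rw [one_mul, sub_eq_add_neg, Real.exp_add]
  ring

theorem integrable_pow_mul_pow_mul_exp_neg {X Y : Ω → ℝ} (hX : Measurable X) (hY : Measurable Y)
    (hX0 : ∀ ω, 0 ≤ X ω) (hY0 : ∀ ω, 0 ≤ Y ω) (k m : ℕ) :
    Integrable (fun ω => X ω ^ k * Y ω ^ m * Real.exp (-X ω - Y ω)) P := by
  refine Integrable.of_bound (C := k.factorial * m.factorial) (by fun_prop)
    (ae_of_all _ fun ω => ?_)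
  have h1 := hX0 ω
  have h2 := hY0 ω
  rw [Real.norm_eq_abs, abs_of_nonneg (by positivity), sub_eq_add_neg, Real.exp_add]
  calc _ = (X ω ^ k * Real.exp (-X ω)) * (Y ω ^ m * Real.exp (-Y ω)) := by ring
    _ ≤ _ := mul_le_mul (pow_mul_exp_neg_le k h1) (pow_mul_exp_neg_le m h2) (by positivity)
      (by positivity)

end Derivatives

/-! ### Gamma variables of integer shape -/

/-- The derivative telescopes: only the top term survives, and it is the Gamma density of shape `n +
1` and rate `r`. -/
theorem hasDerivAt_sum_pow_mul_exp_neg (r : ℝ) (n : ℕ) (u : ℝ) :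
    HasDerivAt (fun u => -∑ k ∈ Finset.range (n + 1),
        (r * u) ^ k / k.factorial * Real.exp (-(r * u)))
      (r * (r * u) ^ n / n.factorial * Real.exp (-(r * u))) u := by
  have hru : HasDerivAt (fun u : ℝ => r * u) r u := by
    simpa using (hasDerivAt_id u).const_mul r
  have hexp : HasDerivAt (fun u : ℝ => Real.exp (-(r * u))) (Real.exp (-(r * u)) * (-r)) u :=
    hru.neg.exp
  induction n with
  | zero =>
    have := hexp.neg
    simp only [zero_add, Finset.range_one, Finset.sum_singleton, pow_zero, Nat.factorial_zero,
      Nat.cast_one, div_one, one_mul, mul_one]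
    convert! this using 1
    ring
  | succ n ih =>
    have h1 := (((hru.pow (n + 1)).div_const ((n + 1).factorial : ℝ)).mul hexp)
    have h2 := ih.sub h1
    convert! h2 using 1
    · ext v
      rw [Finset.sum_range_succ _ (n + 1)]
      simp only [Pi.sub_apply, Pi.mul_apply, Pi.pow_apply]
      ring
    · simp only [Nat.factorial_succ, Pi.pow_apply]
      push_cast
      have h3 : (n.factorial : ℝ) ≠ 0 := by positivity
      have h4 : (n : ℝ) + 1 ≠ 0 := by positivity
      field_simp
      simp

theorem gammaMeasure_Ici {n : ℕ} (hn : 1 ≤ n) {r y : ℝ} (hr : 0 < r) (hy : 0 ≤ y) :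
    gammaMeasure n r (Ici y) =
      ENNReal.ofReal (∑ k ∈ Finset.range n, (r * y) ^ k / k.factorial * Real.exp (-(r * y))) := by
  obtain ⟨n, rfl⟩ : ∃ k, n = k + 1 := ⟨n - 1, by omega⟩
  have hlim : Tendsto (fun u => -∑ k ∈ Finset.range (n + 1),
      (r * u) ^ k / k.factorial * Real.exp (-(r * u))) atTop (𝓝 0) := by
    have : ∀ k ∈ Finset.range (n + 1), Tendsto (fun u : ℝ =>
        (r * u) ^ k / k.factorial * Real.exp (-(r * u))) atTop (𝓝 0) := fun k _ => by
      have h1 := (Real.tendsto_pow_mul_exp_neg_atTop_nhds_zero k).comp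
        (tendsto_id.const_mul_atTop hr)
      have h2 := h1.div_const (k.factorial : ℝ)
      rw [zero_div] at h2
      refine h2.congr fun u => ?_
      simp only [Function.comp_apply, id]
      ring
    simpa using (tendsto_finsetSum _ this).neg
  have hpos : ∀ u ∈ Ioi y, 0 ≤ r * (r * u) ^ n / n.factorial * Real.exp (-(r * u)) :=
    fun u hu => by
      have : 0 < u := lt_of_le_of_lt hy hu
      positivity
  have hint := integral_Ioi_of_hasDerivAt_of_nonneg' (a := y)
    (fun u _ => hasDerivAt_sum_pow_mul_exp_neg r n u) hpos hlim
  have hintg := integrableOn_Ioi_deriv_of_nonneg' (a := y)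
    (fun u _ => hasDerivAt_sum_pow_mul_exp_neg r n u) hpos hlim
  rw [zero_sub, neg_neg] at hint
  rw [← hint, ofReal_integral_eq_lintegral_ofReal hintg
    (by filter_upwards [ae_restrict_mem measurableSet_Ioi] with u hu using hpos u hu),
    ← lintegral_indicator_one measurableSet_Ici, lintegral_gammaMeasure _ _
      (measurable_one.indicator measurableSet_Ici)]
  have hmul : ∀ u, ENNReal.ofReal (r ^ ((n + 1 : ℕ) : ℝ) / Real.Gamma ((n + 1 : ℕ) : ℝ) *
      u ^ (((n + 1 : ℕ) : ℝ) - 1) * Real.exp (-(r * u))) * (Ici y).indicator 1 u =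
      (Ici y).indicator (fun u => ENNReal.ofReal
        (r * (r * u) ^ n / n.factorial * Real.exp (-(r * u)))) u := fun u => by
    by_cases hu : u ∈ Ici y
    · rw [indicator_of_mem hu, indicator_of_mem hu, Pi.one_apply, mul_one, Real.rpow_natCast]
      push_cast
      rw [Real.Gamma_nat_eq_factorial, add_sub_cancel_right, Real.rpow_natCast]
      congr 1
      ring
    · rw [indicator_of_notMem hu, indicator_of_notMem hu, mul_zero]
  simp_rw [hmul]
  rw [lintegral_indicator measurableSet_Ici, Measure.restrict_restrict measurableSet_Ici]
  refine setLIntegral_congr ?_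
  have h4 : Ioi y = Ioi y ∩ Ioi 0 := by
    rw [inter_eq_left.2]
    exact Ioi_subset_Ioi hy
  rw [h4]
  exact Ioi_ae_eq_Ici.symm.inter (ae_eq_refl _)

theorem gammaMeasure_Iio_zero (a r : ℝ) : gammaMeasure a r (Iio 0) = 0 := by
  rw [← lintegral_indicator_one measurableSet_Iio,
    lintegral_gammaMeasure _ _ (measurable_one.indicator measurableSet_Iio)]
  refine setLIntegral_eq_zero measurableSet_Ioi fun u hu => ?_
  rw [indicator_of_notMem (by simpa using le_of_lt hu), mul_zero]
  rfl

/-- As `y ≥ 0`, replacing `T - z` by its positive part does not change the inequality. -/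
theorem ofReal_le_div_add_iff {T w z y : ℝ} (hw : 0 < w) (hz : 0 < z) (hy : 0 ≤ y) :
    ENNReal.ofReal T ≤ ENNReal.ofReal y / ENNReal.ofReal w + ENNReal.ofReal z ↔
      max 0 (T - z) * w ≤ y := by
  rw [← ENNReal.ofReal_div_of_pos hw, ← ENNReal.ofReal_add (by positivity) hz.le,
    ENNReal.ofReal_le_ofReal_iff (by positivity), ← le_div_iff₀ hw, max_le_iff,
    and_iff_right (by positivity), sub_le_iff_le_add]

/-- The conditional success probability of maximal-ratio combining given the interference-plus-noise
powers `w₀` and `w₁` at the two antennas. -/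
theorem gammaMeasure_prod_setOf_le {n : ℕ} (hn : 1 ≤ n) (T : ℝ) {w₀ w₁ : ℝ} (hw₀ : 0 < w₀)
    (hw₁ : 0 < w₁) :
    ((gammaMeasure n n).prod (gammaMeasure n n)) {p | ENNReal.ofReal T ≤
        ENNReal.ofReal p.1 / ENNReal.ofReal w₀ + ENNReal.ofReal p.2 / ENNReal.ofReal w₁} =
      ∫⁻ z in Ioi (0 : ℝ), ∑ k ∈ Finset.range n, ENNReal.ofReal (1 / (k.factorial * Real.Gamma n)) *
        (ENNReal.ofReal z⁻¹ * ENNReal.ofReal ((max 0 (T - z) * w₀ * n) ^ k * (z * w₁ * n) ^ n *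
          Real.exp (-(max 0 (T - z) * w₀ * n) - z * w₁ * n))) := by
  have hn0 : (0 : ℝ) < n := by exact_mod_cast hn
  have hΓ := Real.Gamma_pos_of_pos hn0
  have hpγ := isProbabilityMeasure_gammaMeasure hn0 hn0
  have hmeas : MeasurableSet {p : ℝ × ℝ | ENNReal.ofReal T ≤
      ENNReal.ofReal p.1 / ENNReal.ofReal w₀ + ENNReal.ofReal p.2 / ENNReal.ofReal w₁} :=
    measurableSet_le (by fun_prop) (by fun_prop)
  rw [Measure.prod_apply_symm hmeas, lintegral_gammaMeasure _ _
    (measurable_measure_prodMk_right hmeas)]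
  -- Substituting `g₁ = w₁ z` makes `z` the second antenna's term. The Jacobian times the Gamma
  -- density becomes `z⁻¹ (z w₁ n) ^ n exp (-z w₁ n) / Γ(n)`.
  have him : (fun z : ℝ => w₁ * z) '' Ioi 0 = Ioi 0 := by
    ext y
    constructor
    · rintro ⟨z, hz, rfl⟩
      exact mul_pos hw₁ hz
    · intro hy
      exact ⟨y / w₁, div_pos hy hw₁, by field_simp⟩
  nth_rw 1 [← him]
  rw [lintegral_image_eq_lintegral_abs_deriv_mul (f' := fun _ => w₁) measurableSet_Ioi
    (fun z _ => by simpa using ((hasDerivAt_id z).const_mul w₁).hasDerivWithinAt)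
    (fun u _ v _ huv => mul_left_cancel₀ hw₁.ne' huv)]
  refine setLIntegral_congr_fun measurableSet_Ioi fun z hz => ?_
  have hz0 : 0 < z := hz
  have htail : gammaMeasure n n ((fun y => (y, w₁ * z)) ⁻¹' {p : ℝ × ℝ | ENNReal.ofReal T ≤
      ENNReal.ofReal p.1 / ENNReal.ofReal w₀ + ENNReal.ofReal p.2 / ENNReal.ofReal w₁}) =
      gammaMeasure n n (Ici (max 0 (T - z) * w₀)) := by
    refine measure_congr ?_
    have hae : ∀ᵐ y ∂(gammaMeasure n n), 0 ≤ y := by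
      rw [ae_iff]
      simpa [Iio] using gammaMeasure_Iio_zero n n
    filter_upwards [hae] with y hy
    refine propext ?_
    change ENNReal.ofReal T ≤ ENNReal.ofReal y / ENNReal.ofReal w₀ +
      ENNReal.ofReal (w₁ * z) / ENNReal.ofReal w₁ ↔ max 0 (T - z) * w₀ ≤ y
    rw [← ENNReal.ofReal_div_of_pos hw₁, mul_div_cancel_left₀ _ hw₁.ne']
    exact ofReal_le_div_add_iff hw₀ hz0 hy
  have hmax : 0 ≤ max 0 (T - z) := le_max_left _ _
  rw [htail, gammaMeasure_Ici hn hn0 (by positivity), abs_of_pos hw₁,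
    ← ENNReal.ofReal_mul (by positivity), ← ENNReal.ofReal_mul (by positivity), Finset.mul_sum,
    Finset.mul_sum, ENNReal.ofReal_sum_of_nonneg (fun k _ => by positivity)]
  refine Finset.sum_congr rfl fun k _ => ?_
  rw [← ENNReal.ofReal_mul (by positivity), ← ENNReal.ofReal_mul (by positivity)]
  congr 1
  rw [sub_eq_add_neg (-(max 0 (T - z) * w₀ * n)), Real.exp_add, Real.rpow_natCast,
    Real.rpow_sub_one (by positivity), Real.rpow_natCast,
    show -(n * (max 0 (T - z) * w₀)) = -(max 0 (T - z) * w₀ * n) by ring,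
    show -(n * (w₁ * z)) = -(z * w₁ * n) by ring]
  field_simp
  rw [mul_pow (w₁ * z)]
  ring

/-- The normalized interference-plus-noise power at antenna `n`. -/
noncomputable def totalPower {Ω : Type*} (d α SNR : ℝ) (x : ℕ → Ω → Plane)
    (h : Fin 2 → ℕ → Ω → ℝ) (n : Fin 2) (ω : Ω) : ℝ :=
  (interference d α x (h n) ω).toReal + SNR⁻¹

theorem totalPower_pos {Ω : Type*} {SNR : ℝ} (hSNR : 0 < SNR) (d α : ℝ)
    (x : ℕ → Ω → Plane) (h : Fin 2 → ℕ → Ω → ℝ) (n : Fin 2) (ω : Ω) :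
    0 < totalPower d α SNR x h n ω := by
  unfold totalPower
  positivity

/-! ### Independence of the desired gains and the interference -/

section Independence

variable {Ω : Type*} [MeasurableSpace Ω] {P : Measure Ω}

/-- The hypotheses make the joint law of the three a product, which can be reordered. It turns
independence of locations from fading into independence of desired gains from locations and
interferer fading. -/
theorem IndepFun.left_comm [IsProbabilityMeasure P] {𝓐 𝓑 𝓒 : Type*} [MeasurableSpace 𝓐] [MeasurableSpace 𝓑]
    [MeasurableSpace 𝓒] {A : Ω → 𝓐} {B : Ω → 𝓑} {C : Ω → 𝓒} (hA : Measurable A)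
    (hB : Measurable B) (hC : Measurable C) (hABC : IndepFun A (fun ω => (B ω, C ω)) P)
    (hBC : IndepFun B C P) : IndepFun B (fun ω => (A ω, C ω)) P := by
  have hAC : IndepFun A C P := hABC.comp (φ := id) (ψ := Prod.snd) measurable_id measurable_snd
  have h1 := (indepFun_iff_map_prod_eq_prod_map_map hA.aemeasurable
    (hB.prodMk hC).aemeasurable).1 hABC
  have h2 := (indepFun_iff_map_prod_eq_prod_map_map hB.aemeasurable hC.aemeasurable).1 hBC
  have h3 := (indepFun_iff_map_prod_eq_prod_map_map hA.aemeasurable hC.aemeasurable).1 hAC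
  have hα := Measure.isProbabilityMeasure_map (μ := P) hA.aemeasurable
  have hβ := Measure.isProbabilityMeasure_map (μ := P) hB.aemeasurable
  have hγ := Measure.isProbabilityMeasure_map (μ := P) hC.aemeasurable
  rw [indepFun_iff_map_prod_eq_prod_map_map hB.aemeasurable (hA.prodMk hC).aemeasurable, h3]
  rw [h2] at h1
  have m1 := (measurePreserving_prodAssoc (P.map A) (P.map B) (P.map C)).symm
  have m2 := (Measure.measurePreserving_swap (μ := P.map A) (ν := P.map B)).prod
    (MeasurePreserving.id (P.map C))
  have m3 := measurePreserving_prodAssoc (P.map B) (P.map A) (P.map C)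
  have m := m3.comp (m2.comp m1)
  rw [← m.map_eq, ← h1, Measure.map_map m.measurable (hA.prodMk (hB.prodMk hC))]
  rfl

namespace IsNakagamiPoissonModel

variable {lam d α mD mI : ℝ} {x : ℕ → Ω → Plane} {g : Fin 2 → Ω → ℝ} {h : Fin 2 → ℕ → Ω → ℝ}

/-- Disjoint blocks of an independent family generate independent σ-algebras. -/
theorem indepFun_desired_interf (hmodel : IsNakagamiPoissonModel P 2 lam mD mI x g h) :
    IndepFun (fun ω => (g 0 ω, g 1 ω)) (fun ω n i => h n i ω) P := by
  set f : Fin 2 ⊕ (Fin 2 × ℕ) → Ω → ℝ := Sum.elim g fun q : Fin 2 × ℕ => h q.1 q.2 with hf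
  have hfm : ∀ i, Measurable (f i) := fun i => by
    cases i with
    | inl n => exact hmodel.measurable_desired n
    | inr q => exact hmodel.measurable_interf q.1 q.2
  have hind : Indep (⨆ i ∈ range Sum.inl, MeasurableSpace.comap (f i) inferInstance)
      (⨆ i ∈ range Sum.inr, MeasurableSpace.comap (f i) inferInstance) P := by
    refine indep_iSup_of_disjoint (fun i => (hfm i).comap_le) hmodel.indep_fading.iIndep ?_
    rw [Set.disjoint_iff_forall_ne]
    rintro _ ⟨a, rfl⟩ _ ⟨b, rfl⟩ hab
    cases hab
  have hle : ∀ (S : Set (Fin 2 ⊕ (Fin 2 × ℕ))) (i), i ∈ S →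
      Measurable[⨆ i ∈ S, MeasurableSpace.comap (f i) inferInstance] (f i) := fun S i hi =>
    (comap_measurable (f i)).mono
      (le_iSup₂ (f := fun i (_ : i ∈ S) => MeasurableSpace.comap (f i) inferInstance) i hi) le_rfl
  rw [IndepFun_iff_Indep]
  refine indep_of_indep_of_le_left (indep_of_indep_of_le_right hind ?_) ?_
  · refine Measurable.comap_le ?_
    refine @measurable_pi_lambda _ _ _ (_) _ _ fun n => @measurable_pi_lambda _ _ _ (_) _ _ fun i =>
      hle _ (Sum.inr (n, i)) ⟨_, rfl⟩
  · refine Measurable.comap_le ?_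
    exact @Measurable.prodMk _ _ _ _ _ (_) _ _ (hle _ (Sum.inl 0) ⟨_, rfl⟩)
      (hle _ (Sum.inl 1) ⟨_, rfl⟩)

theorem indepFun_desired_interference [IsProbabilityMeasure P]
    (hmodel : IsNakagamiPoissonModel P 2 lam mD mI x g h) :
    IndepFun (fun ω => (g 0 ω, g 1 ω))
      (fun ω => (interference d α x (h 0) ω, interference d α x (h 1) ω)) P := by
  have hx : Measurable fun ω i => x i ω := measurable_pi_iff.2 hmodel.poisson.measurable
  have hg : Measurable fun ω => (g 0 ω, g 1 ω) :=
    (hmodel.measurable_desired 0).prodMk (hmodel.measurable_desired 1)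
  have hh : Measurable fun ω n i => h n i ω :=
    measurable_pi_iff.2 fun n => measurable_pi_iff.2 fun i => hmodel.measurable_interf n i
  have h1 : IndepFun (fun ω i => x i ω) (fun ω => ((g 0 ω, g 1 ω), fun n i => h n i ω)) P :=
    hmodel.indep_locations.comp (φ := id)
      (ψ := fun p : (Fin 2 → ℝ) × (Fin 2 → ℕ → ℝ) => ((p.1 0, p.1 1), p.2)) measurable_id
      (by fun_prop)
  have h2 := IndepFun.left_comm hx hg hh h1 hmodel.indepFun_desired_interf
  -- Interference is a function of locations and marks, written here by evaluating `interference` on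
  -- the space of such pairs.
  exact h2.comp (φ := id) (ψ := fun p : (ℕ → Plane) × (Fin 2 → ℕ → ℝ) =>
    (interference d α (fun i (q : (ℕ → Plane) × (Fin 2 → ℕ → ℝ)) => q.1 i)
      (fun i q => q.2 0 i) p,
     interference d α (fun i (q : (ℕ → Plane) × (Fin 2 → ℕ → ℝ)) => q.1 i)
      (fun i q => q.2 1 i) p)) measurable_id
    ((measurable_interference _ _ (by fun_prop) (by fun_prop)).prodMk
      (measurable_interference _ _ (by fun_prop) (by fun_prop)))

theorem measurable_totalPower (hmodel : IsNakagamiPoissonModel P 2 lam mD mI x g h) (d α SNR : ℝ)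
    (n : Fin 2) : Measurable (totalPower d α SNR x h n) :=
  (measurable_interference d α hmodel.poisson.measurable fun i =>
    hmodel.measurable_interf n i).ennreal_toReal.add_const _

theorem ofReal_totalPower_ae [IsProbabilityMeasure P]
    (hmodel : IsNakagamiPoissonModel P 2 lam mD mI x g h)
    (hlam : 0 ≤ lam) (hd : 0 < d) (hα : 2 < α) (hmI : 0 < mI) {SNR : ℝ} (hSNR : 0 < SNR) :
    ∀ᵐ ω ∂P, ∀ n, interference d α x (h n) ω + (ENNReal.ofReal SNR)⁻¹ =
      ENNReal.ofReal (totalPower d α SNR x h n ω) := by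
  filter_upwards [hmodel.interference_ae_ne_top hlam hd hα hmI] with ω hω n
  rw [totalPower, ENNReal.ofReal_add ENNReal.toReal_nonneg (by positivity),
    ENNReal.ofReal_toReal (hω n), ENNReal.ofReal_inv_of_pos hSNR]

/-- Independence allows conditioning on the two interference powers, where the Gamma computation
applies. Tonelli then moves the expectation inside the `z`-integral. -/
theorem measure_le_sinrMRC [IsProbabilityMeasure P] {n : ℕ}
    (hmodel : IsNakagamiPoissonModel P 2 lam n mI x g h)
    (hlam : 0 ≤ lam) (hd : 0 < d) (hα : 2 < α) (hmI : 0 < mI) {SNR : ℝ} (hSNR : 0 < SNR)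
    (hn : 1 ≤ n) (T : ℝ) :
    P {ω | ENNReal.ofReal T ≤ sinrMRC d α SNR x g h ω} =
      ∑ k ∈ Finset.range n, ENNReal.ofReal (1 / (k.factorial * Real.Gamma n)) *
        ∫⁻ z in Ioi (0 : ℝ), ENNReal.ofReal z⁻¹ *
          ∫⁻ ω, ENNReal.ofReal ((max 0 (T - z) * totalPower d α SNR x h 0 ω * n) ^ k *
            (z * totalPower d α SNR x h 1 ω * n) ^ n *
            Real.exp (-(max 0 (T - z) * totalPower d α SNR x h 0 ω * n) -
              z * totalPower d α SNR x h 1 ω * n)) ∂P := by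
  have hn0 : (0 : ℝ) < n := by exact_mod_cast hn
  have hpγ := isProbabilityMeasure_gammaMeasure hn0 hn0
  have hg : Measurable fun ω => (g 0 ω, g 1 ω) :=
    (hmodel.measurable_desired 0).prodMk (hmodel.measurable_desired 1)
  have hIm : Measurable fun ω => (interference d α x (h 0) ω, interference d α x (h 1) ω) :=
    (measurable_interference d α hmodel.poisson.measurable fun i =>
      hmodel.measurable_interf 0 i).prodMk (measurable_interference d α hmodel.poisson.measurable
        fun i => hmodel.measurable_interf 1 i)
  have hlaw : P.map (fun ω => (g 0 ω, g 1 ω)) = (gammaMeasure n n).prod (gammaMeasure n n) := by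
    have hind : IndepFun (g 0) (g 1) P :=
      hmodel.indep_fading.indepFun (i := Sum.inl 0) (j := Sum.inl 1) (by simp)
    rw [(indepFun_iff_map_prod_eq_prod_map_map (hmodel.measurable_desired 0).aemeasurable
      (hmodel.measurable_desired 1).aemeasurable).1 hind, (hmodel.law_desired 0).map_eq,
      (hmodel.law_desired 1).map_eq]
  have hjoint := (indepFun_iff_map_prod_eq_prod_map_map hg.aemeasurable hIm.aemeasurable).1
    (hmodel.indepFun_desired_interference (d := d) (α := α))
  set D : Set ((ℝ × ℝ) × (ℝ≥0∞ × ℝ≥0∞)) := {q | ENNReal.ofReal T ≤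
    ENNReal.ofReal q.1.1 / (q.2.1 + (ENNReal.ofReal SNR)⁻¹) +
      ENNReal.ofReal q.1.2 / (q.2.2 + (ENNReal.ofReal SNR)⁻¹)} with hD
  have hDm : MeasurableSet D := measurableSet_le (by fun_prop) (by fun_prop)
  have hw := fun i => hmodel.measurable_totalPower d α SNR i
  have hw0 := hw 0
  have hw1 := hw 1
  have := Measure.isProbabilityMeasure_map (μ := P) hIm.aemeasurable
  calc P {ω | ENNReal.ofReal T ≤ sinrMRC d α SNR x g h ω}
      = (P.map fun ω => ((g 0 ω, g 1 ω),
          (interference d α x (h 0) ω, interference d α x (h 1) ω))) D := by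
        rw [Measure.map_apply (hg.prodMk hIm) hDm]
        simp [sinrMRC, Fin.sum_univ_two, hD]
    _ = ∫⁻ ω, ((gammaMeasure n n).prod (gammaMeasure n n)) {p | ENNReal.ofReal T ≤
          ENNReal.ofReal p.1 / (interference d α x (h 0) ω + (ENNReal.ofReal SNR)⁻¹) +
            ENNReal.ofReal p.2 / (interference d α x (h 1) ω + (ENNReal.ofReal SNR)⁻¹)} ∂P := by
        rw [hjoint, hlaw, Measure.prod_apply_symm hDm,
          lintegral_map (measurable_measure_prodMk_right hDm) hIm]
        rfl
    _ = ∫⁻ ω, (∫⁻ z in Ioi (0 : ℝ), ∑ k ∈ Finset.range n,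
          ENNReal.ofReal (1 / (k.factorial * Real.Gamma n)) * (ENNReal.ofReal z⁻¹ *
            ENNReal.ofReal ((max 0 (T - z) * totalPower d α SNR x h 0 ω * n) ^ k *
              (z * totalPower d α SNR x h 1 ω * n) ^ n *
              Real.exp (-(max 0 (T - z) * totalPower d α SNR x h 0 ω * n) -
                z * totalPower d α SNR x h 1 ω * n)))) ∂P := by
        refine lintegral_congr_ae ?_
        filter_upwards [hmodel.ofReal_totalPower_ae hlam hd hα hmI hSNR] with ω hω
        rw [hω 0, hω 1]
        exact gammaMeasure_prod_setOf_le hn T (totalPower_pos hSNR d α x h 0 ω)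
          (totalPower_pos hSNR d α x h 1 ω)
    _ = _ := by
        rw [lintegral_lintegral_swap (Measurable.aemeasurable (by fun_prop))]
        refine (lintegral_congr fun z => lintegral_finsetSum _ fun k _ => by fun_prop).trans ?_
        refine (lintegral_finsetSum _ fun k _ =>
          Measurable.lintegral_prod_right (by fun_prop)).trans ?_
        refine Finset.sum_congr rfl fun k _ => ?_
        simp_rw [lintegral_const_mul' _ _ ENNReal.ofReal_ne_top]

/-- The noise `SNR⁻¹` is deterministic and splits off as an exponential factor. The rest is the
joint interference transform at weights `(T - z)⁺ s mD` and `z t mD`. -/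
theorem expTerm_eq_integral [IsProbabilityMeasure P] {T : ℝ}
    (hmodel : IsNakagamiPoissonModel P 2 lam mD mI x g h)
    (hlam : 0 ≤ lam) (hd : 0 < d) (hα : 2 < α) (hmD : 0 < mD) (hmI : 0 < mI) {SNR : ℝ}
    (hSNR : 0 < SNR) {z s t : ℝ} (hz : 0 < z) (hs : 0 < s) (ht : 0 < t) :
    expTerm lam d α SNR T mD mI z s t =
      ∫ ω, Real.exp (-(s * (max 0 (T - z) * totalPower d α SNR x h 0 ω * mD))) *
        Real.exp (-(t * (z * totalPower d α SNR x h 1 ω * mD))) ∂P := by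
  have hw0 := hmodel.measurable_totalPower d α SNR 0
  have hw1 := hmodel.measurable_totalPower d α SNR 1
  set a := max 0 (T - z) * s * mD with ha
  set b := z * t * mD with hb
  have ha0 : 0 ≤ a := by
    have : 0 ≤ max 0 (T - z) := le_max_left _ _
    positivity
  have hb0 : 0 ≤ b := by positivity
  rw [integral_eq_lintegral_of_nonneg_ae (ae_of_all _ fun ω => by positivity)
    (by fun_prop)]
  have hint : ∀ᵐ ω ∂P, ENNReal.ofReal
      (Real.exp (-(s * (max 0 (T - z) * totalPower d α SNR x h 0 ω * mD))) *
        Real.exp (-(t * (z * totalPower d α SNR x h 1 ω * mD)))) =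
      ENNReal.ofReal (Real.exp (-(a / SNR) - b / SNR)) *
        expNeg (ENNReal.ofReal a * interference d α x (h 0) ω +
          ENNReal.ofReal b * interference d α x (h 1) ω) := by
    filter_upwards [hmodel.interference_ae_ne_top hlam hd hα hmI] with ω hω
    rw [← ENNReal.ofReal_toReal (hω 0), ← ENNReal.ofReal_toReal (hω 1), ← ENNReal.ofReal_mul ha0,
      ← ENNReal.ofReal_mul hb0, ← ENNReal.ofReal_add (by positivity) (by positivity),
      expNeg_ofReal (by positivity), ← ENNReal.ofReal_mul (by positivity), ← Real.exp_add,
      ← Real.exp_add]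
    congr 2
    rw [totalPower, totalPower, ha, hb]
    field_simp
    ring
  have hA := calA_nonneg (d := d) (T := T) hα hmD hmI hz hs ht
  have hπ := Real.pi_pos
  rw [lintegral_congr_ae hint, lintegral_const_mul' _ _ ENNReal.ofReal_ne_top,
    hmodel.lintegral_expNeg_interference hlam hd hα hmI ENNReal.ofReal_ne_top ENNReal.ofReal_ne_top,
    ofReal_mul_lintegral_eq_calA hlam hα hmD hmI hz hs ht, expNeg_ofReal (by positivity),
    ← ENNReal.ofReal_mul (by positivity), ENNReal.toReal_ofReal (by positivity), ← Real.exp_add,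
    expTerm]
  congr 1

end IsNakagamiPoissonModel

end Independence

/-! ### Smoothness of the differentiated function. -/

theorem contDiffAt_expTerm {lam d α SNR T mD mI : ℝ} (hmI : 0 < mI) {z : ℝ}
    (hz : 0 < z) :
    ContDiffAt ℝ (⊤ : ℕ∞) (fun p : ℝ × ℝ => expTerm lam d α SNR T mD mI z p.1 p.2) (1, 1) := by
  have hA : ContDiffAt ℝ (⊤ : ℕ∞) (fun p : ℝ × ℝ => calA d α T mD mI z p.1 p.2) (1, 1) := by
    unfold calA
    -- The branch depends on `z` and `T` alone, so no gluing in `(s, t)` is needed. For `z < T` the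
    -- Gauss argument at `(1, 1)` is below `1`, where the function is analytic.
    split_ifs with hzT
    · have hTz := sub_pos.2 hzT
      have hw : ContDiffAt ℝ (⊤ : ℕ∞)
          (fun p : ℝ × ℝ => 1 - z * p.2 / ((T - z) * p.1)) (1, 1) := by
        refine contDiffAt_const.sub (ContDiffAt.div ?_ ?_ ?_)
        · fun_prop
        · fun_prop
        · simpa using hTz.ne'
      have hreg := ContDiffAt.comp (𝕜 := ℝ) ((1, 1) : ℝ × ℝ)
        (contDiffAt_regularizedGaussReal (-(2 / α)) (b := mI) (c := 2 * mI) hmI (by linarith)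
          (w := 1 - z * 1 / ((T - z) * 1)) (by
            have : 0 < z * 1 / ((T - z) * 1) := by positivity
            linarith)) hw
      have hs : ContDiffAt ℝ (⊤ : ℕ∞) (fun p : ℝ × ℝ => p.1 ^ (2 / α)) (1, 1) :=
        contDiffAt_fst.rpow_const_of_ne one_ne_zero
      exact (((((hs.mul contDiffAt_const).mul contDiffAt_const).mul contDiffAt_const).mul
        contDiffAt_const).mul contDiffAt_const).mul hreg
    · have hs : ContDiffAt ℝ (⊤ : ℕ∞) (fun p : ℝ × ℝ => (z * p.2) ^ (2 / α)) (1, 1) :=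
        (contDiffAt_const.mul contDiffAt_snd).rpow_const_of_ne (by simpa using hz.ne')
      exact (((hs.mul contDiffAt_const).mul contDiffAt_const).mul contDiffAt_const).mul
        contDiffAt_const
  unfold expTerm
  refine ContDiffAt.exp (ContDiffAt.sub ?_ (contDiffAt_const.mul hA))
  fun_prop

end DualBranchMRC

/-! ### Assembly of the formula. -/

open DualBranchMRC in
theorem theorem1 {Ω : Type*} [MeasurableSpace Ω] (P : Measure Ω) [IsProbabilityMeasure P]
    (lam d α SNR T mI : ℝ) (mD : ℕ)
    (hlam : 0 < lam) (hd : 0 < d) (hα : 2 < α) (hSNR : 0 < SNR) (hT : 0 < T)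
    (hmD : 1 ≤ mD) (hmI : 0 < mI)
    (x : ℕ → Ω → Plane) (g : Fin 2 → Ω → ℝ) (h : Fin 2 → ℕ → Ω → ℝ)
    (hmodel : IsNakagamiPoissonModel P 2 lam mD mI x g h) :
    (∀ z : ℝ, 0 < z →
      ContDiffAt ℝ (⊤ : ℕ∞) (fun p : ℝ × ℝ => expTerm lam d α SNR T mD mI z p.1 p.2) (1, 1)) ∧
    (∀ k ∈ Finset.range mD, IntegrableOn
      (fun z : ℝ => z⁻¹ * mixedDeriv k mD (expTerm lam d α SNR T mD mI z)) (Ioi 0)) ∧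
    successProb P d α SNR T x g h =
      ∑ k ∈ Finset.range mD,
        (-1 : ℝ) ^ (k + mD) / ((k.factorial : ℝ) * Real.Gamma mD) *
          ∫ z in Ioi (0 : ℝ), z⁻¹ * mixedDeriv k mD (expTerm lam d α SNR T mD mI z) := by
  have hmD0 : (0 : ℝ) < mD := by exact_mod_cast hmD
  have hΓ := Real.Gamma_pos_of_pos hmD0
  have hw0 := hmodel.measurable_totalPower d α SNR 0
  have hw1 := hmodel.measurable_totalPower d α SNR 1
  have hmax : ∀ z, 0 ≤ max 0 (T - z) := fun z => le_max_left _ _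
  set X : ℝ → Ω → ℝ := fun z ω => max 0 (T - z) * totalPower d α SNR x h 0 ω * mD with hX
  set Y : ℝ → Ω → ℝ := fun z ω => z * totalPower d α SNR x h 1 ω * mD with hY
  have hXm : ∀ z, Measurable (X z) := fun z => by fun_prop
  have hYm : ∀ z, Measurable (Y z) := fun z => by fun_prop
  have hX0 : ∀ z ω, 0 ≤ X z ω := fun z ω => by
    have h1 := totalPower_pos hSNR d α x h 0 ω
    have h2 := hmax z
    positivity
  have hY0 : ∀ z, 0 < z → ∀ ω, 0 ≤ Y z ω := fun z hz ω => by
    have h1 := totalPower_pos hSNR d α x h 1 ω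
    positivity
  set M : ℕ → ℝ → ℝ := fun k z => ∫ ω, X z ω ^ k * Y z ω ^ mD * Real.exp (-X z ω - Y z ω) ∂P with hM
  have hM0 : ∀ k z, 0 < z → 0 ≤ M k z := fun k z hz => integral_nonneg fun ω => by
    have h1 := hX0 z ω
    have h2 := hY0 z hz ω
    positivity
  have hMl : ∀ k z, 0 < z → ENNReal.ofReal (M k z) = ∫⁻ ω, ENNReal.ofReal
      (X z ω ^ k * Y z ω ^ mD * Real.exp (-X z ω - Y z ω)) ∂P := fun k z hz => by
    rw [hM, ofReal_integral_eq_lintegral_ofReal (integrable_pow_mul_pow_mul_exp_neg (hXm z) (hYm z)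
      (hX0 z) (hY0 z hz) k mD) (ae_of_all _ fun ω => ?_)]
    have h1 := hX0 z ω
    have h2 := hY0 z hz ω
    positivity
  have hMm : ∀ k, Measurable (M k) := fun k => by
    refine (StronglyMeasurable.integral_prod_right (f := fun z ω =>
      X z ω ^ k * Y z ω ^ mD * Real.exp (-X z ω - Y z ω)) ?_).measurable
    exact Measurable.stronglyMeasurable (by fun_prop)
  have hderiv : ∀ k, ∀ z ∈ Ioi (0 : ℝ),
      z⁻¹ * mixedDeriv k mD (expTerm lam d α SNR T mD mI z) = (-1) ^ (k + mD) * (z⁻¹ * M k z) :=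
    fun k z hz => by
    rw [mixedDeriv_eq_integral (hXm z) (hYm z) (hX0 z) (hY0 z hz) (fun s t hs ht =>
      hmodel.expTerm_eq_integral hlam.le hd hα hmD0 hmI hSNR hz hs ht)]
    ring
  have hprob := hmodel.measure_le_sinrMRC hlam.le hd hα hmI hSNR hmD T
  have hlint : ∀ k, ∫⁻ z in Ioi (0 : ℝ), ENNReal.ofReal z⁻¹ * ∫⁻ ω, ENNReal.ofReal
      (X z ω ^ k * Y z ω ^ mD * Real.exp (-X z ω - Y z ω)) ∂P =
      ∫⁻ z in Ioi (0 : ℝ), ENNReal.ofReal (z⁻¹ * M k z) := fun k => by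
    refine setLIntegral_congr_fun measurableSet_Ioi fun z hz => ?_
    rw [ENNReal.ofReal_mul (inv_nonneg.2 (le_of_lt hz)), hMl k z hz]
  have hprob' : P {ω | ENNReal.ofReal T ≤ sinrMRC d α SNR x g h ω} = ∑ k ∈ Finset.range mD,
      ENNReal.ofReal (1 / (k.factorial * Real.Gamma mD)) *
        ∫⁻ z in Ioi (0 : ℝ), ENNReal.ofReal (z⁻¹ * M k z) := by
    rw [hprob]
    exact Finset.sum_congr rfl fun k _ => by rw [← hlint k]
  -- A finite sum of nonnegative terms equal to a probability has finite terms; with positive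
  -- coefficients this yields the absolute convergence.
  have hterm_ne : ∀ k ∈ Finset.range mD, ENNReal.ofReal (1 / (k.factorial * Real.Gamma mD)) *
      ∫⁻ z in Ioi (0 : ℝ), ENNReal.ofReal (z⁻¹ * M k z) ≠ ∞ := by
    rw [← ENNReal.sum_ne_top, ← hprob']
    exact measure_ne_top _ _
  have hnonneg : ∀ k, 0 ≤ᵐ[volume.restrict (Ioi (0 : ℝ))] fun z => z⁻¹ * M k z := fun k => by
    filter_upwards [ae_restrict_mem measurableSet_Ioi] with z hz
    exact mul_nonneg (inv_nonneg.2 (le_of_lt hz)) (hM0 k z hz)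
  have hmeas : ∀ k, AEStronglyMeasurable (fun z => z⁻¹ * M k z) (volume.restrict (Ioi (0 : ℝ))) :=
    fun k => (measurable_inv.mul (hMm k)).aestronglyMeasurable
  have hint : ∀ k ∈ Finset.range mD, IntegrableOn (fun z => z⁻¹ * M k z) (Ioi 0) := by
    intro k hk
    refine (lintegral_ofReal_ne_top_iff_integrable (hmeas k) (hnonneg k)).1 fun htop => ?_
    refine hterm_ne k hk ?_
    rw [htop, ENNReal.mul_top]
    exact (ENNReal.ofReal_pos.2 (by positivity)).ne'
  refine ⟨fun z hz => contDiffAt_expTerm hmI hz, fun k hk => ?_, ?_⟩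
  · exact IntegrableOn.congr_fun (Integrable.const_mul (hint k hk) _)
      (fun z hz => (hderiv k z hz).symm) measurableSet_Ioi
  · rw [successProb, Measure.real, hprob', ENNReal.toReal_sum hterm_ne]
    refine Finset.sum_congr rfl fun k _ => ?_
    -- The sign in the formula cancels the sign coming from the `k + mD` differentiations.
    have hsq : (-1 : ℝ) ^ (k + mD) * (-1) ^ (k + mD) = 1 := by simp [← mul_pow]
    rw [setIntegral_congr_fun measurableSet_Ioi (hderiv k), integral_const_mul,
      ENNReal.toReal_mul, ENNReal.toReal_ofReal (by positivity),
      ← integral_eq_lintegral_of_nonneg_ae (hnonneg k) (hmeas k), div_mul_eq_mul_div,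
      div_mul_eq_mul_div, ← mul_assoc, hsq]
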